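/- Let $\mathring{\mathfrak g}$ be a finite-dimensional simple complex Lie algebra with Cartan subalgebra $\mathring{\mathfrak h}$, root system $\mathring\Delta$, root spaces $\mathbb C x_\alpha$ ($\alpha\in\mathring\Delta$) and Killing form $\kappa$. Let $$\mathfrak g=\mathring{\mathfrak g}\otimes\mathbb C[t^{\pm1}]\oplus\mathbb Cc\oplus\mathbb Cd$$ be the untwisted affine Kac–Moody algebra, with $c$ central, $$[x\otimes t^m,y\otimes t^n]=[x,y]\otimes t^{m+n}+m\,\delta_{m+n,0}\,\kappa(x,y)\,c,\qquad [d,x\otimes t^n]=n\,x\otimes t^n,$$ and let $\mathfrak h=\mathring{\mathfrak h}\oplus\mathbb Cc\oplus\mathbb Cd$ be its Cartan subalgebra, with root set $\Delta$ (the nonzero $\alpha\in\mathfrak h^*$ with $\mathfrak g_\alpha\neq0$). A *symmetric regular subalgebra* of $\mathfrak g$ is an $\mathfrak h$-invariant Lie subalgebra $\mathfrak s$ such that $\Delta(\mathfrak s)=\{\alpha\in\Delta:\mathfrak g_\alpha\cap\mathfrak s\neq0\}$ satisfies $\Delta(\mathfrak s)=-\Delta(\mathfrak s)$. It is *maximal*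 if it is proper and not properly contained in any other proper symmetric regular subalgebra. A *closed subroot system* of $\mathring\Delta$ is a (possibly empty) subset $\mathring\Psi\subseteq\mathring\Delta$ such that $s_\alpha(\beta)\in\mathring\Psi$ for all $\alpha,\beta\in\mathring\Psi$, and $\alpha+\beta\in\mathring\Psi$ whenever $\alpha,\beta\in\mathring\Psi$ and $\alpha+\beta\in\mathring\Delta$; a proper one is *maximal* if it is not properly contained in another proper one. A function $f:\mathring\Delta\to\mathbb Z$ is *$\mathbb Z$-linear* if it extends to an additive map on the root lattice $\mathbb Z\mathring\Delta$. **Theorem.** A subspace $\mathfrak s\subseteq\mathfrak g$ is a maximal symmetric regular subalgebra if and only if one of the following holds: 1. $\mathfrak s=[\mathfrak g,\mathfrak g]$; 2. there is a maximal closed subroot system $\mathring\Psi\subsetneq\mathring\Delta$ with $$\mathfrak s=\mathfrak h\oplus\bigoplus_{\alpha\in\mathring\Psi,\ r\in\mathbb Z}\mathbb C(x_\alpha\otimes t^r)\oplus\bigoplus_{r\in\mathbb Z\setminus\{0\}}\mathring{\mathfrak h}\otimes t^r;$$ 3. there are a prime number $k$ and a $\mathbb Z$-linear function $f:\mathring\Delta\to\mathbb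 Z$ with $$\mathfrak s=\bigoplus_{\alpha\in\mathring\Delta,\ r\in\mathbb Z}\mathbb C(x_\alpha\otimes t^{f(\alpha)+kr})\oplus\bigoplus_{r\in\mathbb Z}\mathring{\mathfrak h}\otimes t^{kr}\oplus\mathbb Cc\oplus\mathbb Cd.$$ -/

import Mathlib

open scoped TensorProduct

noncomputable section

namespace UntwistedAffine

/-! ### The loop algebra `L ⊗ ℂ[t, t⁻¹]` -/

section Loop

variable (L : Type*) [LieRing L] [LieAlgebra ℂ L]

/-- The linear map `x ↦ x ⊗ t ^ n` into the loop algebra. -/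
def mono (n : ℤ) : L →ₗ[ℂ] LieAlgebra.loopAlgebra ℂ ℤ L :=
  TensorProduct.mk ℂ (AddMonoidAlgebra ℂ ℤ) L (AddMonoidAlgebra.single n 1)

/-- The derivation `t d/dt` of the loop algebra: `x ⊗ t ^ n ↦ n • (x ⊗ t ^ n)`. -/
def degDer : LieAlgebra.loopAlgebra ℂ ℤ L →ₗ[ℂ] LieAlgebra.loopAlgebra ℂ ℤ L :=
  (LieAlgebra.LoopAlgebra.toFinsupp ℂ ℤ L).symm.toLinearMap ∘ₗ
    (Finsupp.lsum ℂ fun n : ℤ => (n : ℂ) • Finsupp.lsingle n) ∘ₗ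
      (LieAlgebra.LoopAlgebra.toFinsupp ℂ ℤ L).toLinearMap

/-- The 2-cocycle `(x ⊗ t ^ m, y ⊗ t ^ n) ↦ m * δ_{m + n, 0} * κ(x, y)` on the loop algebra, where
`κ` is the Killing form. -/
def cocycle : LinearMap.BilinForm ℂ (LieAlgebra.loopAlgebra ℂ ℤ L) :=
  (LieAlgebra.LoopAlgebra.residuePairing ℂ ℤ L (killingForm ℂ L)).flip

variable {L}

lemma toFinsupp_mono (n : ℤ) (x : L) :
    LieAlgebra.LoopAlgebra.toFinsupp ℂ ℤ L (mono L n x) = Finsupp.single n x :=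
  LieAlgebra.LoopAlgebra.toFinsupp_single_tmul ℂ ℤ L n x

lemma toFinsupp_symm_single' (n : ℤ) (x : L) :
    (LieAlgebra.LoopAlgebra.toFinsupp ℂ ℤ L).symm (Finsupp.single n x) = mono L n x :=
  LieAlgebra.LoopAlgebra.toFinsupp_symm_single ℂ ℤ L n x

lemma degDer_mono (n : ℤ) (x : L) : degDer L (mono L n x) = (n : ℂ) • mono L n x := by
  change (LieAlgebra.LoopAlgebra.toFinsupp ℂ ℤ L).symm
    ((Finsupp.lsum ℂ fun n : ℤ => (n : ℂ) • Finsupp.lsingle n)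
      (LieAlgebra.LoopAlgebra.toFinsupp ℂ ℤ L (mono L n x))) = _
  rw [toFinsupp_mono, Finsupp.lsum_single, LinearMap.smul_apply, Finsupp.lsingle_apply,
    map_smul, toFinsupp_symm_single']

lemma loop_induction {p : LieAlgebra.loopAlgebra ℂ ℤ L → Prop}
    (a : LieAlgebra.loopAlgebra ℂ ℤ L) (hm : ∀ n x, p (mono L n x))
    (ha : ∀ a b, p a → p b → p (a + b)) : p a := by
  obtain ⟨f, rfl⟩ := (LieAlgebra.LoopAlgebra.toFinsupp ℂ ℤ L).symm.surjective a
  induction f using Finsupp.induction_linear with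
  | zero => simpa using hm 0 0
  | add f g hf hg => rw [map_add]; exact ha _ _ hf hg
  | single n x => rw [toFinsupp_symm_single']; exact hm n x

/-! The next facts restate the axioms of a Lie algebra for the additive and the scalar structure
that the tensor product carries by itself. -/

lemma loop_add_lie (a b c : LieAlgebra.loopAlgebra ℂ ℤ L) : ⁅a + b, c⁆ = ⁅a, c⁆ + ⁅b, c⁆ :=
  add_lie a b c

lemma loop_lie_add (a b c : LieAlgebra.loopAlgebra ℂ ℤ L) : ⁅a, b + c⁆ = ⁅a, b⁆ + ⁅a, c⁆ :=
  lie_add a b c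

lemma loop_smul_lie (r : ℂ) (a b : LieAlgebra.loopAlgebra ℂ ℤ L) : ⁅r • a, b⁆ = r • ⁅a, b⁆ :=
  smul_lie r a b

lemma loop_lie_smul (r : ℂ) (a b : LieAlgebra.loopAlgebra ℂ ℤ L) : ⁅a, r • b⁆ = r • ⁅a, b⁆ :=
  lie_smul r a b

lemma loop_lie_self (a : LieAlgebra.loopAlgebra ℂ ℤ L) : ⁅a, a⁆ = 0 :=
  lie_self a

lemma loop_lie_skew (a b : LieAlgebra.loopAlgebra ℂ ℤ L) : ⁅a, b⁆ = -⁅b, a⁆ :=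
  (lie_skew a b).symm

lemma loop_leibniz (a b c : LieAlgebra.loopAlgebra ℂ ℤ L) : ⁅a, ⁅b, c⁆⁆ = ⁅⁅a, b⁆, c⁆ + ⁅b, ⁅a, c⁆⁆ :=
  LieRing.leibniz_lie a b c

lemma lie_mono (m n : ℤ) (x y : L) : ⁅mono L m x, mono L n y⁆ = mono L (m + n) ⁅x, y⁆ := by
  change ⁅(AddMonoidAlgebra.single m (1 : ℂ)) ⊗ₜ[ℂ] x, (AddMonoidAlgebra.single n (1 : ℂ)) ⊗ₜ[ℂ] y⁆
    = _
  rw [LieAlgebra.ExtendScalars.bracket_tmul, AddMonoidAlgebra.single_mul_single, one_mul]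
  rfl

lemma cocycle_mono (m n : ℤ) (x y : L) :
    cocycle L (mono L m x) (mono L n y) =
      if m + n = 0 then (m : ℂ) * killingForm ℂ L x y else 0 := by
  change LieAlgebra.LoopAlgebra.residuePairing ℂ ℤ L (killingForm ℂ L) (mono L n y) (mono L m x) = _
  rw [LieAlgebra.LoopAlgebra.residuePairing_apply_apply,
    toFinsupp_mono, toFinsupp_mono, Finsupp.sum_single_index (by simp), Finsupp.single_apply]
  split_ifs with h1 h2 h2
  · rw [LieModule.traceForm_comm]; simp
  · omega
  · omega
  · simp

lemma degDer_lie (a b : LieAlgebra.loopAlgebra ℂ ℤ L) :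
    degDer L ⁅a, b⁆ = ⁅degDer L a, b⁆ + ⁅a, degDer L b⁆ := by
  induction a using loop_induction with
  | ha a a' h h' => simp only [loop_add_lie, map_add, h, h']; abel
  | hm m x =>
    induction b using loop_induction with
    | ha b b' h h' => simp only [loop_lie_add, map_add, h, h']; abel
    | hm n y =>
      simp only [lie_mono, degDer_mono, loop_smul_lie, loop_lie_smul, ← add_smul, Int.cast_add]

lemma cocycle_skew (a b : LieAlgebra.loopAlgebra ℂ ℤ L) : cocycle L a b = -cocycle L b a := by
  induction a using loop_induction with
  | ha a a' h h' => simp only [map_add, LinearMap.add_apply, h, h']; abel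
  | hm m x =>
    induction b using loop_induction with
    | ha b b' h h' => simp only [map_add, LinearMap.add_apply, h, h']; abel
    | hm n y =>
      rw [cocycle_mono, cocycle_mono, add_comm n m, LieModule.traceForm_comm]
      split_ifs with h
      · obtain rfl : n = -m := by omega
        push_cast; ring
      · simp

lemma cocycle_degDer (a b : LieAlgebra.loopAlgebra ℂ ℤ L) :
    cocycle L a (degDer L b) = -cocycle L (degDer L a) b := by
  induction a using loop_induction with
  | ha a a' h h' => simp only [map_add, LinearMap.add_apply, h, h']; abel
  | hm m x =>
    induction b using loop_induction with
    | ha b b' h h' => simp only [map_add, h, h']; abel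
    | hm n y =>
      simp only [degDer_mono, map_smul, LinearMap.smul_apply, cocycle_mono, smul_eq_mul]
      split_ifs with h
      · obtain rfl : n = -m := by omega
        push_cast; ring
      · simp

lemma cocycle_leibniz (a b c : LieAlgebra.loopAlgebra ℂ ℤ L) :
    cocycle L a ⁅b, c⁆ = cocycle L ⁅a, b⁆ c + cocycle L b ⁅a, c⁆ := by
  induction a using loop_induction with
  | ha a a' h h' => simp only [loop_add_lie, map_add, LinearMap.add_apply, h, h']; abel
  | hm m x =>
    induction b using loop_induction with
    | ha b b' h h' => simp only [loop_add_lie, loop_lie_add, map_add, LinearMap.add_apply, h, h']; abel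
    | hm n y =>
      induction c using loop_induction with
      | ha c c' h h' => simp only [loop_lie_add, map_add, h, h']; abel
      | hm k z =>
        simp only [lie_mono, cocycle_mono]
        have e1 : killingForm ℂ L x ⁅y, z⁆ = killingForm ℂ L ⁅x, y⁆ z :=
          (LieModule.traceForm_apply_lie_apply ℂ L L x y z).symm
        have e2 : killingForm ℂ L y ⁅x, z⁆ = -killingForm ℂ L ⁅x, y⁆ z := by
          rw [LieModule.traceForm_lieInvariant ℂ L L x y z, neg_neg]
        by_cases h : m + n + k = 0
        · rw [if_pos (by omega), if_pos (by omega), if_pos (by omega), e1, e2]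
          push_cast; ring
        · rw [if_neg (by omega), if_neg (by omega), if_neg (by omega), add_zero]

end Loop

/-! ### The untwisted affine Lie algebra `L ⊗ ℂ[t, t⁻¹] ⊕ ℂ c ⊕ ℂ d` -/

/-- The untwisted affine Lie algebra attached to `L`: the element `⟨a, z, w⟩` is `a + z c + w d`. -/
@[ext] structure Affine (L : Type*) [LieRing L] [LieAlgebra ℂ L] where
  /-- The component in the loop algebra `L ⊗ ℂ[t, t⁻¹]`. -/
  loop : LieAlgebra.loopAlgebra ℂ ℤ L
  /-- The coefficient of the central element `c`. -/
  central : ℂ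
  /-- The coefficient of the degree derivation `d`. -/
  deg : ℂ

namespace Affine

variable {L : Type*} [LieRing L] [LieAlgebra ℂ L]

/-- As a type, the affine Lie algebra is a product; the vector space structure is componentwise. -/
def equivProd : Affine L ≃ LieAlgebra.loopAlgebra ℂ ℤ L × ℂ × ℂ where
  toFun x := (x.loop, x.central, x.deg)
  invFun p := ⟨p.1, p.2.1, p.2.2⟩

instance : AddCommGroup (Affine L) := equivProd.addCommGroup

instance : Module ℂ (Affine L) := equivProd.module ℂ

@[simp] lemma loop_zero : (0 : Affine L).loop = 0 := rfl
@[simp] lemma central_zero : (0 : Affine L).central = 0 := rfl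
@[simp] lemma deg_zero : (0 : Affine L).deg = 0 := rfl
@[simp] lemma loop_add (x y : Affine L) : (x + y).loop = x.loop + y.loop := rfl
@[simp] lemma central_add (x y : Affine L) : (x + y).central = x.central + y.central := rfl
@[simp] lemma deg_add (x y : Affine L) : (x + y).deg = x.deg + y.deg := rfl
@[simp] lemma loop_smul (r : ℂ) (x : Affine L) : (r • x).loop = r • x.loop := rfl
@[simp] lemma central_smul (r : ℂ) (x : Affine L) : (r • x).central = r * x.central := rfl
@[simp] lemma deg_smul (r : ℂ) (x : Affine L) : (r • x).deg = r * x.deg := rfl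

/-- `[a + z c + w d, a' + z' c + w' d] = [a, a'] + w (t d/dt) a' - w' (t d/dt) a + ω(a, a') c`,
where `ω` is the cocycle above. -/
instance : Bracket (Affine L) (Affine L) where
  bracket x y :=
    ⟨⁅x.loop, y.loop⁆ + x.deg • degDer L y.loop - y.deg • degDer L x.loop,
      cocycle L x.loop y.loop, 0⟩

lemma loop_lie (x y : Affine L) :
    ⁅x, y⁆.loop = ⁅x.loop, y.loop⁆ + x.deg • degDer L y.loop - y.deg • degDer L x.loop := rfl
lemma central_lie (x y : Affine L) : ⁅x, y⁆.central = cocycle L x.loop y.loop := rfl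
@[simp] lemma deg_lie (x y : Affine L) : ⁅x, y⁆.deg = 0 := rfl

instance : LieRing (Affine L) where
  add_lie x y z := by
    ext1
    · simp only [loop_lie, loop_add, deg_add, loop_add_lie, map_add, add_smul, smul_add]; abel
    · simp only [central_lie, loop_add, central_add, map_add, LinearMap.add_apply]
    · simp
  lie_add x y z := by
    ext1
    · simp only [loop_lie, loop_add, deg_add, loop_lie_add, map_add, add_smul, smul_add]; abel
    · simp only [central_lie, loop_add, central_add, map_add]
    · simp
  lie_self x := by
    ext1
    · simp only [loop_lie, loop_lie_self, zero_add, sub_self, loop_zero]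
    · have h := cocycle_skew x.loop x.loop
      rw [central_lie, central_zero]
      linear_combination (1 / 2 : ℂ) * h
    · simp
  leibniz_lie x y z := by
    ext1
    · have e (a b c : LieAlgebra.loopAlgebra ℂ ℤ L) : ⁅a, b - c⁆ = ⁅a, b⁆ - ⁅a, c⁆ := lie_sub a b c
      have e' (a b c : LieAlgebra.loopAlgebra ℂ ℤ L) : ⁅a - b, c⁆ = ⁅a, c⁆ - ⁅b, c⁆ := sub_lie a b c
      simp only [loop_lie, loop_add, deg_lie, loop_add_lie, loop_lie_add, e, e', loop_smul_lie,
        loop_lie_smul, map_add, map_sub, map_smul, degDer_lie, zero_smul, add_zero,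
        sub_zero, smul_add, smul_sub, loop_leibniz x.loop y.loop z.loop,
        loop_lie_skew (degDer L x.loop) y.loop]
      module
    · simp only [loop_lie, central_lie, central_add, map_add, map_sub, map_smul,
        LinearMap.add_apply, LinearMap.sub_apply, LinearMap.smul_apply, smul_eq_mul,
        cocycle_leibniz x.loop y.loop z.loop, cocycle_degDer]
      have h1 := cocycle_degDer x.loop y.loop
      rw [cocycle_skew x.loop (degDer L y.loop)] at h1
      linear_combination z.deg * h1
    · simp

instance : LieAlgebra ℂ (Affine L) where
  lie_smul r x y := by
    ext1
    · simp only [loop_lie, loop_smul, deg_smul, loop_lie_smul, map_smul, smul_sub, smul_add,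
        mul_smul, smul_comm r x.deg]
    · simp [central_lie]
    · simp

variable (L) in
/-- The linear map `x ↦ x ⊗ t ^ n` into the affine Lie algebra. -/
def tpow (n : ℤ) : L →ₗ[ℂ] Affine L where
  toFun x := ⟨mono L n x, 0, 0⟩
  map_add' x y := by ext1 <;> simp
  map_smul' r x := by ext1 <;> simp

variable (L) in
/-- The central element `c`. -/
def c : Affine L := ⟨0, 1, 0⟩

variable (L) in
/-- The degree derivation `d`. -/
def d : Affine L := ⟨0, 0, 1⟩

lemma lie_tpow (m n : ℤ) (x y : L) : ⁅tpow L m x, tpow L n y⁆ =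
    tpow L (m + n) ⁅x, y⁆ + (if m + n = 0 then (m : ℂ) * killingForm ℂ L x y else 0) • c L := by
  ext1
  · simp [-ite_smul, loop_lie, tpow, c, lie_mono]
  · simp [-ite_smul, central_lie, tpow, c, cocycle_mono]
  · simp [-ite_smul, tpow, c]

lemma d_lie_tpow (n : ℤ) (x : L) : ⁅d L, tpow L n x⁆ = (n : ℂ) • tpow L n x := by
  ext1
  · have e (b : LieAlgebra.loopAlgebra ℂ ℤ L) : ⁅(0 : LieAlgebra.loopAlgebra ℂ ℤ L), b⁆ = 0 :=
      zero_lie b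
    simp [loop_lie, tpow, d, degDer_mono, e]
  · simp [central_lie, tpow, d]
  · simp [tpow]

lemma c_lie (x : Affine L) : ⁅c L, x⁆ = 0 := by
  ext1
  · have e (b : LieAlgebra.loopAlgebra ℂ ℤ L) : ⁅(0 : LieAlgebra.loopAlgebra ℂ ℤ L), b⁆ = 0 :=
      zero_lie b
    simp [loop_lie, c, e]
  · simp [central_lie, c]
  · simp

lemma degDer_mono_zero (x : L) : degDer L (mono L 0 x) = 0 := by
  rw [degDer_mono, Int.cast_zero, zero_smul]

/-- The Cartan subalgebra `H ⊗ 1 ⊕ ℂ c ⊕ ℂ d` of the affine Lie algebra. -/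
def cartan (H : LieSubalgebra ℂ L) : LieSubalgebra ℂ (Affine L) where
  carrier := {x | x.loop ∈ H.toSubmodule.map (mono L 0)}
  add_mem' {x y} hx hy := (H.toSubmodule.map (mono L 0)).add_mem hx hy
  zero_mem' := (H.toSubmodule.map (mono L 0)).zero_mem
  smul_mem' r x hx := (H.toSubmodule.map (mono L 0)).smul_mem r hx
  lie_mem' {x y} hx hy := by
    obtain ⟨u, hu, hu'⟩ := hx
    obtain ⟨v, hv, hv'⟩ := hy
    refine ⟨⁅u, v⁆, H.lie_mem hu hv, ?_⟩
    rw [loop_lie, ← hu', ← hv', degDer_mono_zero, degDer_mono_zero, smul_zero, smul_zero,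
      add_zero, sub_zero, lie_mono, add_zero]

end Affine

/-! ### Symmetric regular subalgebras -/

section Regular

variable {g : Type*} [LieRing g] [LieAlgebra ℂ g] (h : LieSubalgebra ℂ g)

/-- The space `g_α = {x | [y, x] = α(y) x for all y ∈ h}`. -/
def weightSpace (α : Module.Dual ℂ h) : Submodule ℂ g where
  carrier := {x | ∀ y : h, ⁅(y : g), x⁆ = α y • x}
  add_mem' {x z} hx hz y := by rw [lie_add, hx y, hz y, smul_add]
  zero_mem' y := by rw [lie_zero, smul_zero]
  smul_mem' r x hx y := by rw [lie_smul, hx y, smul_comm]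

/-- The set `Δ` of roots of `g` with respect to `h`. -/
def roots : Set (Module.Dual ℂ h) := {α | α ≠ 0 ∧ weightSpace h α ≠ ⊥}

/-- The set `Δ(s)` of the roots `α` of `g` with `g_α ∩ s ≠ 0`. -/
def rootsOf (s : Submodule ℂ g) : Set (Module.Dual ℂ h) := {α ∈ roots h | weightSpace h α ⊓ s ≠ ⊥}

/-- The subspace `s` of `g` is a symmetric regular subalgebra: an `h`-invariant Lie subalgebra with
`Δ(s) = -Δ(s)`. -/
structure IsSymmetricRegular (s : Submodule ℂ g) : Prop where
  lie_mem : ∀ x ∈ s, ∀ y ∈ s, ⁅x, y⁆ ∈ s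
  invariant : ∀ y ∈ h, ∀ x ∈ s, ⁅y, x⁆ ∈ s
  symmetric : ∀ α, α ∈ rootsOf h s ↔ -α ∈ rootsOf h s

/-- A proper symmetric regular subalgebra that is not properly contained in another one. -/
def IsMaximalSymmetricRegular (s : Submodule ℂ g) : Prop :=
  Maximal (fun s' => IsSymmetricRegular h s' ∧ s' ≠ ⊤) s

end Regular

/-! ### The finite root system and the subalgebras in the classification -/

section Finite

variable {L : Type*} [LieRing L] [LieAlgebra ℂ L] [FiniteDimensional ℂ L] [LieAlgebra.IsSimple ℂ L]
  (H : LieSubalgebra ℂ L) [H.IsCartanSubalgebra]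

/-- A closed subroot system of the root system of `(L, H)`: a set of roots (possibly empty) that is
stable under the reflections in its elements and contains every root that is a sum of two of its
elements. -/
structure IsClosedSubroot (Ψ : Set H.root) : Prop where
  reflection_mem : ∀ i ∈ Ψ, ∀ j ∈ Ψ, (LieAlgebra.IsKilling.rootSystem H).reflectionPerm i j ∈ Ψ
  add_mem : ∀ i ∈ Ψ, ∀ j ∈ Ψ, ∀ k, (LieAlgebra.IsKilling.rootSystem H).root k =
    (LieAlgebra.IsKilling.rootSystem H).root i + (LieAlgebra.IsKilling.rootSystem H).root j → k ∈ Ψ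

/-- A maximal one among the proper closed subroot systems. -/
def IsMaximalClosedSubroot (Ψ : Set H.root) : Prop :=
  Maximal (fun Ψ' => IsClosedSubroot H Ψ' ∧ Ψ' ≠ Set.univ) Ψ

/-- `f` is `ℤ`-linear: it is the restriction of an additive function on the root lattice. -/
def IsZLinear (f : H.root → ℤ) : Prop :=
  ∃ F : Submodule.span ℤ (Set.range (LieAlgebra.IsKilling.rootSystem H).root) →ₗ[ℤ] ℤ,
    ∀ i, f i = F ⟨(LieAlgebra.IsKilling.rootSystem H).root i,
      Submodule.subset_span (Set.mem_range_self i)⟩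

/-- `L_α ⊗ t ^ n` for a root `α` of `(L, H)`. -/
def rootTpow (α : H.root) (n : ℤ) : Submodule ℂ (Affine L) :=
  (LieAlgebra.rootSpace H α.1).toSubmodule.map (Affine.tpow L n)

/-- `H ⊗ t ^ n`. -/
def cartanTpow (n : ℤ) : Submodule ℂ (Affine L) :=
  H.toSubmodule.map (Affine.tpow L n)

/-- `𝔥 ⊕ ⨁_{α ∈ Ψ, r ∈ ℤ} L_α ⊗ t ^ r ⊕ ⨁_{r ≠ 0} H ⊗ t ^ r`, where `𝔥` is the affine Cartan
subalgebra. -/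
def gradientSubspace (Ψ : Set H.root) : Submodule ℂ (Affine L) :=
  (Affine.cartan H).toSubmodule ⊔ (⨆ α ∈ Ψ, ⨆ r : ℤ, rootTpow H α r) ⊔
    ⨆ r : ℤ, ⨆ _ : r ≠ 0, cartanTpow H r

/-- `⨁_{α, r} L_α ⊗ t ^ (f(α) + k r) ⊕ ⨁_r H ⊗ t ^ (k r) ⊕ ℂ c`, where `α` runs over all roots and
`r` over `ℤ`. -/
def congruenceSubspace (k : ℕ) (f : H.root → ℤ) : Submodule ℂ (Affine L) :=
  (⨆ α : H.root, ⨆ r : ℤ, rootTpow H α (f α + k * r)) ⊔ (⨆ r : ℤ, cartanTpow H (k * r)) ⊔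
    Submodule.span ℂ {Affine.c L}

end Finite

end UntwistedAffine

end

/-! Write `g`, `h` for the affine algebra and its Cartan subalgebra, and let `s` be maximal. Since
`h` is abelian and normalises `s`, `[s + h, s + h] ⊆ s`; in particular `s + h` is again symmetric
regular, with the same roots. If `s + h = g`, then `s ⊇ [g, g]`, a hyperplane, so `s = [g, g]`.
Otherwise maximality gives `h ⊆ s`. As `c, d ∈ s`, such an `s` is graded by the action of `d` and
amounts to a family of subspaces `S n` of `L` with `[S m, S n] ⊆ S (m + n)`, `H ⊆ S 0` and a
symmetry under negation; the cocycle no longer matters (`eq_ofFamily`, `isSymmetricFamily`).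

The roots `α` with `L_α ⊆ S n` for some `n` form a closed subroot system, the gradient. If it is
proper, `s` lies in the subalgebra of case 2 for any maximal closed subroot system containing the
gradient, and equals it.

If the gradient is everything, choose a degree for each simple root and extend linearly to `F` on
the root lattice; induction over roots gives `L_α ⊆ S (F α)` for all `α` (`exists_linear`). For
fixed `n`, the sum of the spaces `L_x ∩ S (n + F x)` over the root lattice is then an ideal of `L`,
so by simplicity it is `0` or `L` (`rootSub_le_of_exists_mem`). The shifts `n` for which it is `L`
form a subgroup `kℤ`, and `k` and `F` determine `S`. Enlarging `kℤ` to `pℤ` for a prime `p` dividing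
`k` enlarges `s`, so maximality yields case 3.

Conversely, an overalgebra of a subalgebra from case 2 or 3 contains `h`, so the same dichotomy
applies to it; the degrees `n` with `H ⊗ t ^ n` inside then bound the modulus. -/

noncomputable section

set_option linter.unusedSectionVars false

namespace UntwistedAffine

namespace Affine

/-! ### Homogeneous components and graded subspaces -/

section Coeff

variable {L : Type*} [LieRing L] [LieAlgebra ℂ L]

variable (L) in
/-- The coefficient of `t ^ n` in the loop component. -/
def coeff (n : ℤ) : Affine L →ₗ[ℂ] L where
  toFun x := LieAlgebra.LoopAlgebra.toFinsupp ℂ ℤ L x.loop n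
  map_add' x y := by simp
  map_smul' r x := by simp

lemma coeff_tpow (m n : ℤ) (x : L) : coeff L m (tpow L n x) = if n = m then x else 0 := by
  change LieAlgebra.LoopAlgebra.toFinsupp ℂ ℤ L (mono L n x) m = _
  rw [toFinsupp_mono, Finsupp.single_apply]

@[simp] lemma coeff_tpow_self (n : ℤ) (x : L) : coeff L n (tpow L n x) = x := by
  rw [coeff_tpow, if_pos rfl]

@[simp] lemma coeff_c (n : ℤ) : coeff L n (c L) = 0 := by
  change LieAlgebra.LoopAlgebra.toFinsupp ℂ ℤ L 0 n = 0
  simp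

@[simp] lemma coeff_d (n : ℤ) : coeff L n (d L) = 0 := by
  change LieAlgebra.LoopAlgebra.toFinsupp ℂ ℤ L 0 n = 0
  simp

lemma tpow_injective (n : ℤ) : Function.Injective (tpow L n) :=
  Function.LeftInverse.injective (coeff_tpow_self n)

/-- The degrees in which the loop component does not vanish. -/
def supp (x : Affine L) : Finset ℤ := (LieAlgebra.LoopAlgebra.toFinsupp ℂ ℤ L x.loop).support

lemma eq_sum (x : Affine L) :
    x = ∑ n ∈ x.supp, tpow L n (coeff L n x) + x.central • c L + x.deg • d L := by
  have hl (f : ℤ → L) (s : Finset ℤ) : (∑ n ∈ s, tpow L n (f n)) =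
      ⟨∑ n ∈ s, mono L n (f n), 0, 0⟩ := by
    classical
    induction s using Finset.induction_on with
    | empty => rfl
    | insert a s ha ih =>
      rw [Finset.sum_insert ha, Finset.sum_insert ha, ih]
      ext1 <;> simp [tpow]
  rw [hl]
  ext1
  · simp only [loop_add, loop_smul, c, d, smul_zero, add_zero]
    apply (LieAlgebra.LoopAlgebra.toFinsupp ℂ ℤ L).injective
    rw [map_sum]
    simp_rw [toFinsupp_mono]
    exact (Finsupp.sum_single (LieAlgebra.LoopAlgebra.toFinsupp ℂ ℤ L x.loop)).symm
  · simp [c, d]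
  · simp [c, d]

lemma lie_c (x : Affine L) : ⁅x, c L⁆ = 0 := by rw [← lie_skew, c_lie, neg_zero]

lemma lie_d_tpow (n : ℤ) (x : L) : ⁅tpow L n x, d L⁆ = -(n : ℂ) • tpow L n x := by
  rw [← lie_skew, d_lie_tpow, neg_smul]

@[elab_as_elim]
lemma induction_on {p : Affine L → Prop} (x : Affine L) (ht : ∀ n y, p (tpow L n y))
    (hc : p (c L)) (hd : p (d L)) (ha : ∀ x y, p x → p y → p (x + y))
    (hs : ∀ (r : ℂ) x, p x → p (r • x)) : p x := by
  rw [eq_sum x]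
  refine ha _ _ (ha _ _ ?_ (hs _ _ hc)) (hs _ _ hd)
  refine Finset.sum_induction _ p ha ?_ fun n _ => ht _ _
  simpa using hs 0 _ hc

lemma coeff_d_lie (n : ℤ) (x : Affine L) : coeff L n ⁅d L, x⁆ = (n : ℂ) • coeff L n x := by
  induction x using induction_on with
  | ht m y =>
    rw [d_lie_tpow, map_smul, coeff_tpow]
    split_ifs with h
    · rw [h]
    · simp
  | hc => simp [lie_c]
  | hd => simp
  | ha x y hx hy => simp [hx, hy]
  | hs r x hx => simp only [lie_smul, map_smul, hx, smul_comm r]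

/-- The elements with coefficient of `t ^ n` in `S n` for all `n`. -/
def ofFamily (S : ℤ → Submodule ℂ L) : Submodule ℂ (Affine L) where
  carrier := {x | ∀ n, coeff L n x ∈ S n}
  add_mem' hx hy n := by rw [map_add]; exact (S n).add_mem (hx n) (hy n)
  zero_mem' n := by rw [map_zero]; exact (S n).zero_mem
  smul_mem' r x hx n := by rw [map_smul]; exact (S n).smul_mem r (hx n)

variable {S S' : ℤ → Submodule ℂ L}

lemma c_mem_ofFamily : c L ∈ ofFamily S := fun n => by simp

lemma d_mem_ofFamily : d L ∈ ofFamily S := fun n => by simp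

lemma tpow_mem_ofFamily {n : ℤ} {x : L} : tpow L n x ∈ ofFamily S ↔ x ∈ S n := by
  refine ⟨fun h => by simpa using h n, fun h m => ?_⟩
  rw [coeff_tpow]
  split_ifs with hm
  · exact hm ▸ h
  · exact zero_mem _

lemma ofFamily_le_ofFamily : ofFamily S ≤ ofFamily S' ↔ ∀ n, S n ≤ S' n :=
  ⟨fun h _ _ hx => tpow_mem_ofFamily.1 (h (tpow_mem_ofFamily.2 hx)), fun h _ hx n => h n (hx n)⟩

lemma ofFamily_le {s : Submodule ℂ (Affine L)} (hS : ∀ n, ∀ x ∈ S n, tpow L n x ∈ s)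
    (hc : c L ∈ s) (hd : d L ∈ s) : ofFamily S ≤ s := by
  intro x hx
  rw [eq_sum x]
  exact add_mem (add_mem (sum_mem fun n _ => hS n _ (hx n)) (s.smul_mem _ hc)) (s.smul_mem _ hd)

lemma ofFamily_eq_top : ofFamily S = ⊤ ↔ ∀ n, S n = ⊤ := by
  constructor
  · intro h n
    rw [eq_top_iff]
    exact fun x _ => tpow_mem_ofFamily.1 (h ▸ Submodule.mem_top)
  · intro h
    rw [eq_top_iff]
    intro x _ n
    rw [h n]
    trivial

/-- Central terms cost nothing because `c` lies in every `ofFamily S`, and bracketing with `d` only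
rescales coefficients. -/
lemma ofFamily_lie_mem (h : ∀ m n, ∀ x ∈ S m, ∀ y ∈ S n, ⁅x, y⁆ ∈ S (m + n))
    {x y : Affine L} (hx : x ∈ ofFamily S) (hy : y ∈ ofFamily S) : ⁅x, y⁆ ∈ ofFamily S := by
  have h1 {z : Affine L} (hz : z ∈ ofFamily S) (n : ℤ) (u : L) (hu : u ∈ S n) :
      ⁅tpow L n u, z⁆ ∈ ofFamily S := by
    rw [eq_sum z, lie_add, lie_add, lie_smul, lie_smul, lie_c, lie_d_tpow, lie_sum]
    refine add_mem (add_mem (sum_mem fun m _ => ?_) (by simp)) ?_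
    · rw [lie_tpow]
      exact add_mem (tpow_mem_ofFamily.2 (h _ _ _ hu _ (hz m)))
        (Submodule.smul_mem _ _ c_mem_ofFamily)
    · exact Submodule.smul_mem _ _ (Submodule.smul_mem _ _ (tpow_mem_ofFamily.2 hu))
  rw [eq_sum x, add_lie, add_lie, smul_lie, smul_lie, c_lie, sum_lie]
  refine add_mem (add_mem (sum_mem fun m _ => h1 hy _ _ (hx m)) (by simp))
    (Submodule.smul_mem _ _ fun n => ?_)
  rw [coeff_d_lie]
  exact Submodule.smul_mem _ _ (hy n)

/-- Eigenvectors of `ad d` for distinct eigenvalues can be separated inside an invariant subspace.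
The multiples of `c` and `d`, on which `ad d` vanishes, are subtracted first, so that they do not
interfere with degree `0`. -/
lemma tpow_coeff_mem {s : Submodule ℂ (Affine L)} (hc : c L ∈ s) (hd : d L ∈ s)
    (hs : ∀ x ∈ s, ⁅d L, x⁆ ∈ s) {x : Affine L} (hx : x ∈ s) (n : ℤ) :
    tpow L n (coeff L n x) ∈ s := by
  have key (F : Finset ℤ) : ∀ f : ℤ → L, ∑ n ∈ F, tpow L n (f n) ∈ s →
      ∀ n ∈ F, tpow L n (f n) ∈ s := by
    classical
    induction F using Finset.induction_on with
    | empty => simp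
    | insert a F ha ih =>
      intro f hf
      -- `ad d - a` kills the term of degree `a` and multiplies the term of degree `n` by `n - a`,
      -- which is nonzero for `n ∈ F`.
      have h1 : ∑ n ∈ F, tpow L n (((n : ℂ) - a) • f n) ∈ s := by
        have h2 := sub_mem (hs _ hf) (s.smul_mem (a : ℂ) hf)
        rw [Finset.sum_insert ha, lie_add, smul_add, lie_sum, d_lie_tpow, add_sub_add_left_eq_sub,
          Finset.smul_sum, ← Finset.sum_sub_distrib] at h2
        convert h2 using 2 with n hn
        rw [d_lie_tpow, map_smul, sub_smul]
      have h3 : ∀ n ∈ F, tpow L n (f n) ∈ s := fun n hn => by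
        have h4 := ih _ h1 n hn
        rw [map_smul] at h4
        refine (s.smul_mem_iff ?_).1 h4
        rw [sub_ne_zero]
        exact_mod_cast fun h : n = a => ha (h ▸ hn)
      intro n hn
      rcases Finset.mem_insert.1 hn with rfl | hn
      · rw [Finset.sum_insert ha] at hf
        exact (s.add_mem_iff_left (sum_mem h3)).1 hf
      · exact h3 n hn
  by_cases hn : n ∈ x.supp
  · refine key x.supp (fun m => coeff L m x) ?_ n hn
    rw [eq_sum x] at hx
    exact (s.add_mem_iff_left (s.smul_mem _ hc)).1 ((s.add_mem_iff_left (s.smul_mem _ hd)).1 hx)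
  · have : coeff L n x = 0 := Finsupp.notMem_support_iff.1 hn
    rw [this, map_zero]
    exact zero_mem _

lemma eq_ofFamily {s : Submodule ℂ (Affine L)} (hc : c L ∈ s) (hd : d L ∈ s)
    (hs : ∀ x ∈ s, ⁅d L, x⁆ ∈ s) : s = ofFamily fun n => s.comap (tpow L n) :=
  le_antisymm (fun _ hx n => tpow_coeff_mem hc hd hs hx n) (ofFamily_le (fun _ _ hx => hx) hc hd)

end Coeff

/-! ### Weight vectors for the affine Cartan subalgebra -/

section Cartan

variable {L : Type*} [LieRing L] [LieAlgebra ℂ L] (H : LieSubalgebra ℂ L)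

lemma tpow_zero_mem_cartan {u : L} (hu : u ∈ H) : tpow L 0 u ∈ cartan H := ⟨u, hu, rfl⟩

lemma c_mem_cartan : c L ∈ cartan H := ⟨0, H.zero_mem, map_zero _⟩

lemma d_mem_cartan : d L ∈ cartan H := ⟨0, H.zero_mem, map_zero _⟩

variable {H}

lemma exists_of_mem_cartan {y : Affine L} (hy : y ∈ cartan H) :
    ∃ u ∈ H, y = tpow L 0 u + y.central • c L + y.deg • d L := by
  obtain ⟨u, hu, huy⟩ := hy
  exact ⟨u, hu, by ext1 <;> simp [tpow, c, d, huy]⟩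

lemma cartan_le {s : Submodule ℂ (Affine L)} (hs : ∀ u ∈ H, tpow L 0 u ∈ s) (hc : c L ∈ s)
    (hd : d L ∈ s) : (cartan H).toSubmodule ≤ s := by
  intro y hy
  obtain ⟨u, hu, huy⟩ := exists_of_mem_cartan hy
  rw [huy]
  exact add_mem (add_mem (hs u hu) (s.smul_mem _ hc)) (s.smul_mem _ hd)

lemma lie_tpow_of_cartan (u : L) (z w : ℂ) (n : ℤ) (x : L) :
    ⁅tpow L 0 u + z • c L + w • d L, tpow L n x⁆ = tpow L n (⁅u, x⁆ + (n * w : ℂ) • x) := by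
  rw [add_lie, add_lie, smul_lie, smul_lie, c_lie, d_lie_tpow, lie_tpow, map_add, map_smul, zero_add]
  simp [smul_smul, mul_comm]

/-- A vector of nonzero weight is a multiple of a bracket with some `y ∈ h`. Hence it has no
`d`-component, and no `c`-component either because the cocycle vanishes against degree `0`. The
eigenvalue of `d` then singles out one degree. -/
lemma exists_of_mem_weightSpace {lam : Module.Dual ℂ (cartan H)} (h0 : lam ≠ 0) {x : Affine L}
    (hx : x ∈ weightSpace (cartan H) lam) : ∃ (n : ℤ) (z : L), x = tpow L n z := by
  obtain ⟨y, hy⟩ : ∃ y, lam y ≠ 0 := by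
    by_contra! h
    exact h0 (LinearMap.ext h)
  have hxy : x = (lam y)⁻¹ • ⁅(y : Affine L), x⁆ := by rw [hx y, inv_smul_smul₀ hy]
  have hdeg : x.deg = 0 := by rw [hxy]; simp
  have hcen : x.central = 0 := by
    rw [hxy, central_smul, central_lie]
    obtain ⟨u, hu, huy⟩ := exists_of_mem_cartan y.2
    have h1 : (y : Affine L).loop = mono L 0 u := by rw [huy]; simp [tpow, c, d]
    rw [h1]
    have h2 (a : LieAlgebra.loopAlgebra ℂ ℤ L) : cocycle L (mono L 0 u) a = 0 := by
      induction a using loop_induction with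
      | ha a b h h' => rw [map_add, h, h', add_zero]
      | hm n x => rw [cocycle_mono]; simp
    rw [h2, mul_zero]
  have hd (m : ℤ) : ((m : ℂ) - lam ⟨d L, d_mem_cartan H⟩) • coeff L m x = 0 := by
    rw [sub_smul, ← coeff_d_lie, ← map_smul, ← hx ⟨d L, d_mem_cartan H⟩, sub_self]
  by_cases hn : ∃ n : ℤ, (n : ℂ) = lam ⟨d L, d_mem_cartan H⟩
  · obtain ⟨n, hn⟩ := hn
    refine ⟨n, coeff L n x, ?_⟩
    conv_lhs => rw [eq_sum x, hcen, hdeg, zero_smul, zero_smul, add_zero, add_zero]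
    refine Finset.sum_eq_single n (fun m _ hm => ?_) (fun h => ?_)
    · rw [(smul_eq_zero.1 (hd m)).resolve_left, map_zero]
      rw [← hn]
      exact sub_ne_zero.2 (Int.cast_injective.ne hm)
    · rw [show coeff L n x = 0 from Finsupp.notMem_support_iff.1 h, map_zero]
  -- If `d` acts by a non-integer, every coefficient vanishes and `x = 0`.
  · refine ⟨0, 0, ?_⟩
    rw [eq_sum x, hcen, hdeg, zero_smul, zero_smul, add_zero, add_zero, map_zero]
    refine Finset.sum_eq_zero fun m _ => ?_
    rw [(smul_eq_zero.1 (hd m)).resolve_left, map_zero]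
    exact sub_ne_zero.2 fun h => hn ⟨m, h⟩

lemma lam_apply_d_of_tpow_mem {lam : Module.Dual ℂ (cartan H)} {n : ℤ} {x : L} (hx0 : x ≠ 0)
    (hx : tpow L n x ∈ weightSpace (cartan H) lam) : lam ⟨d L, d_mem_cartan H⟩ = n := by
  have h : ⁅d L, tpow L n x⁆ = _ := hx ⟨d L, d_mem_cartan H⟩
  rw [d_lie_tpow] at h
  have h0 : tpow L n x ≠ 0 := fun h0 => hx0 (tpow_injective n (h0.trans (map_zero _).symm))
  exact (smul_left_injective ℂ h0 h).symm

lemma lam_apply_c_of_tpow_mem {lam : Module.Dual ℂ (cartan H)} {n : ℤ} {x : L} (hx0 : x ≠ 0)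
    (hx : tpow L n x ∈ weightSpace (cartan H) lam) : lam ⟨c L, c_mem_cartan H⟩ = 0 := by
  have h : ⁅c L, tpow L n x⁆ = _ := hx ⟨c L, c_mem_cartan H⟩
  rw [c_lie] at h
  exact (smul_eq_zero.1 h.symm).resolve_right
    fun h0 => hx0 (tpow_injective n (h0.trans (map_zero _).symm))

lemma lie_of_tpow_mem {lam : Module.Dual ℂ (cartan H)} {n : ℤ} {x : L}
    (hx : tpow L n x ∈ weightSpace (cartan H) lam) (u : H) :
    ⁅(u : L), x⁆ = lam ⟨tpow L 0 u, tpow_zero_mem_cartan H u.2⟩ • x := by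
  have h : ⁅tpow L 0 (u : L), tpow L n x⁆ = _ := hx ⟨tpow L 0 u, tpow_zero_mem_cartan H u.2⟩
  rw [← map_smul] at h
  apply tpow_injective n
  rw [← h, lie_tpow]
  simp

lemma tpow_mem_weightSpace {lam : Module.Dual ℂ (cartan H)} {n : ℤ} {x : L}
    (hd : lam ⟨d L, d_mem_cartan H⟩ = n) (hc : lam ⟨c L, c_mem_cartan H⟩ = 0)
    (hx : ∀ u : H, ⁅(u : L), x⁆ = lam ⟨tpow L 0 u, tpow_zero_mem_cartan H u.2⟩ • x) :
    tpow L n x ∈ weightSpace (cartan H) lam := by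
  rintro ⟨y, hy⟩
  obtain ⟨u, hu, huy⟩ := exists_of_mem_cartan hy
  have h1 : (⟨y, hy⟩ : cartan H) = ⟨tpow L 0 u, tpow_zero_mem_cartan H hu⟩ +
      y.central • ⟨c L, c_mem_cartan H⟩ + y.deg • ⟨d L, d_mem_cartan H⟩ := Subtype.ext huy
  rw [h1, map_add, map_add, map_smul, map_smul, hd, hc, ← h1]
  change ⁅y, tpow L n x⁆ = _
  conv_lhs => rw [huy]
  rw [lie_tpow_of_cartan, hx ⟨u, hu⟩, ← map_smul]
  congr 1
  rw [smul_zero, add_zero, smul_eq_mul, add_smul, mul_comm (n : ℂ)]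

/-- The component in `H` of an element of the affine Cartan subalgebra. -/
def cartanPart : cartan H →ₗ[ℂ] H where
  toFun y := ⟨coeff L 0 (y : Affine L), by
    obtain ⟨u, hu, huy⟩ := exists_of_mem_cartan y.2
    rw [huy]
    simpa using hu⟩
  map_add' y z := Subtype.ext (map_add (coeff L 0) (y : Affine L) z)
  map_smul' r y := Subtype.ext (map_smul (coeff L 0) r (y : Affine L))

/-- The weight `y ↦ α(y) + n δ(y)` of the affine Cartan subalgebra. -/
def affineWeight (α : Module.Dual ℂ H) (n : ℤ) : Module.Dual ℂ (cartan H) where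
  toFun y := α (cartanPart y) + n * (y : Affine L).deg
  map_add' y z := by
    change α (cartanPart (y + z)) + n * ((y : Affine L) + z).deg = _
    rw [map_add, map_add, deg_add]
    ring
  map_smul' r y := by
    change α (cartanPart (r • y)) + n * (r • (y : Affine L)).deg = _
    rw [map_smul, map_smul, deg_smul, RingHom.id_apply, smul_eq_mul, smul_eq_mul]
    ring

lemma affineWeight_tpow (α : Module.Dual ℂ H) (n : ℤ) (u : H) :
    affineWeight α n ⟨tpow L 0 u, tpow_zero_mem_cartan H u.2⟩ = α u := by
  have h : cartanPart ⟨tpow L 0 u, tpow_zero_mem_cartan H u.2⟩ = u :=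
    Subtype.ext (coeff_tpow_self 0 (u : L))
  change α (cartanPart _) + n * 0 = _
  rw [h, mul_zero, add_zero]

lemma affineWeight_c (α : Module.Dual ℂ H) (n : ℤ) :
    affineWeight α n ⟨c L, c_mem_cartan H⟩ = 0 := by
  have h : cartanPart ⟨c L, c_mem_cartan H⟩ = 0 := Subtype.ext (coeff_c 0)
  change α (cartanPart _) + n * 0 = _
  rw [h, map_zero, mul_zero, add_zero]

lemma affineWeight_d (α : Module.Dual ℂ H) (n : ℤ) :
    affineWeight α n ⟨d L, d_mem_cartan H⟩ = n := by
  have h : cartanPart ⟨d L, d_mem_cartan H⟩ = 0 := Subtype.ext (coeff_d 0)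
  change α (cartanPart _) + n * 1 = _
  rw [h, map_zero, mul_one, zero_add]

end Cartan

end Affine

open UntwistedAffine.Affine

/-! ### Symmetric regular subalgebras as graded families -/

section Family

variable {L : Type*} [LieRing L] [LieAlgebra ℂ L] (H : LieSubalgebra ℂ L)

/-- The conditions on the coefficient spaces of a symmetric regular subalgebra that contains the
affine Cartan subalgebra. -/
structure IsSymmetricFamily (S : ℤ → Submodule ℂ L) : Prop where
  lie_mem : ∀ m n, ∀ x ∈ S m, ∀ y ∈ S n, ⁅x, y⁆ ∈ S (m + n)
  cartan_le : H.toSubmodule ≤ S 0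
  symmetric : ∀ (α : Module.Dual ℂ H) n, (∃ x ∈ S n, x ≠ 0 ∧ ∀ u : H, ⁅(u : L), x⁆ = α u • x) →
    ∃ x ∈ S (-n), x ≠ 0 ∧ ∀ u : H, ⁅(u : L), x⁆ = -α u • x

variable {H} {S : ℤ → Submodule ℂ L} {s : Submodule ℂ (Affine L)}

lemma mem_rootsOf_iff {lam : Module.Dual ℂ (cartan H)} (h0 : lam ≠ 0) :
    lam ∈ rootsOf (cartan H) s ↔ ∃ x ∈ s, x ≠ 0 ∧ x ∈ weightSpace (cartan H) lam := by
  constructor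
  · rintro ⟨-, h⟩
    obtain ⟨x, hx, hx0⟩ := Submodule.exists_mem_ne_zero_of_ne_bot h
    exact ⟨x, hx.2, hx0, hx.1⟩
  · rintro ⟨x, hx, hx0, hx'⟩
    refine ⟨⟨h0, ?_⟩, ?_⟩
    · exact fun h => hx0 ((Submodule.eq_bot_iff _).1 h x hx')
    · exact fun h => hx0 ((Submodule.eq_bot_iff _).1 h x ⟨hx', hx⟩)

lemma symmetric_of_imp (h : ∀ α, α ∈ rootsOf (cartan H) s → -α ∈ rootsOf (cartan H) s)
    (α : Module.Dual ℂ (cartan H)) : α ∈ rootsOf (cartan H) s ↔ -α ∈ rootsOf (cartan H) s :=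
  ⟨h α, fun h' => neg_neg α ▸ h _ h'⟩

lemma IsSymmetricFamily.cartan_le_ofFamily (hS : IsSymmetricFamily H S) :
    (cartan H).toSubmodule ≤ ofFamily S :=
  Affine.cartan_le (fun _ hu => tpow_mem_ofFamily.2 (hS.cartan_le hu)) c_mem_ofFamily d_mem_ofFamily

lemma IsSymmetricFamily.isSymmetricRegular (hS : IsSymmetricFamily H S) :
    IsSymmetricRegular (cartan H) (ofFamily S) where
  lie_mem _ hx _ hy := ofFamily_lie_mem hS.lie_mem hx hy
  invariant _ hy _ hx := ofFamily_lie_mem hS.lie_mem (hS.cartan_le_ofFamily hy) hx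
  symmetric := by
    refine symmetric_of_imp fun lam hlam => ?_
    have h0 : lam ≠ 0 := hlam.1.1
    rw [mem_rootsOf_iff h0] at hlam
    obtain ⟨x, hx, hx0, hlx⟩ := hlam
    rw [mem_rootsOf_iff (neg_ne_zero.2 h0)]
    obtain ⟨n, z, rfl⟩ := exists_of_mem_weightSpace h0 hlx
    have hz0 : z ≠ 0 := fun h => hx0 (by rw [h, map_zero])
    rw [tpow_mem_ofFamily] at hx
    -- The restriction of `lam` to `H ⊗ 1` along `i` is the finite weight to which the symmetry of
    -- the family applies.
    let i : H →ₗ[ℂ] cartan H :=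
      { toFun := fun u => ⟨tpow L 0 u, tpow_zero_mem_cartan H u.2⟩
        map_add' := fun u v => Subtype.ext (map_add (tpow L 0) (u : L) v)
        map_smul' := fun r u => Subtype.ext (map_smul (tpow L 0) r (u : L)) }
    obtain ⟨y, hy, hy0, hyu⟩ := hS.symmetric (lam ∘ₗ i) n ⟨z, hx, hz0, lie_of_tpow_mem hlx⟩
    refine ⟨tpow L (-n) y, tpow_mem_ofFamily.2 hy,
      fun h => hy0 (tpow_injective _ (h.trans (map_zero _).symm)), tpow_mem_weightSpace ?_ ?_ hyu⟩
    · rw [LinearMap.neg_apply, lam_apply_d_of_tpow_mem hz0 hlx, Int.cast_neg]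
    · rw [LinearMap.neg_apply, lam_apply_c_of_tpow_mem hz0 hlx, neg_zero]

lemma IsSymmetricRegular.eq_ofFamily (hs : IsSymmetricRegular (cartan H) s)
    (h : (cartan H).toSubmodule ≤ s) : s = ofFamily fun n => s.comap (tpow L n) :=
  Affine.eq_ofFamily (h (c_mem_cartan H)) (h (d_mem_cartan H)) (hs.invariant _ (d_mem_cartan H))

lemma IsSymmetricRegular.isSymmetricFamily (hs : IsSymmetricRegular (cartan H) s)
    (h : (cartan H).toSubmodule ≤ s) : IsSymmetricFamily H fun n => s.comap (tpow L n) where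
  lie_mem m n x hx y hy := by
    have h1 := hs.lie_mem _ hx _ hy
    rw [lie_tpow] at h1
    exact (s.add_mem_iff_left (s.smul_mem _ (h (c_mem_cartan H)))).1 h1
  cartan_le _ hu := h (tpow_zero_mem_cartan H hu)
  symmetric α n := by
    rintro ⟨x, hx, hx0, hxu⟩
    -- The zero weight is not a root, so the symmetry of `s` says nothing about it. It forces `n =
    -- 0` and `α = 0`, where `x` is its own partner.
    by_cases h0 : affineWeight α n = 0
    · have hn : n = 0 := by
        have := affineWeight_d α n
        rw [h0, LinearMap.zero_apply] at this
        exact_mod_cast this.symm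
      have hα : α = 0 := by
        ext u
        rw [← affineWeight_tpow α n, h0]
        rfl
      subst hn hα
      exact ⟨x, by simpa using hx, hx0, by simpa using hxu⟩
    · have h1 : affineWeight α n ∈ rootsOf (cartan H) s := by
        rw [mem_rootsOf_iff h0]
        refine ⟨tpow L n x, hx, fun h => hx0 (tpow_injective _ (h.trans (map_zero _).symm)),
          tpow_mem_weightSpace (affineWeight_d α n) (affineWeight_c α n) fun u => ?_⟩
        rw [affineWeight_tpow, hxu]
      rw [hs.symmetric, mem_rootsOf_iff (neg_ne_zero.2 h0)] at h1
      obtain ⟨y, hy, hy0, hly⟩ := h1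
      obtain ⟨m, z, rfl⟩ := exists_of_mem_weightSpace (neg_ne_zero.2 h0) hly
      have hz0 : z ≠ 0 := fun h => hy0 (by rw [h, map_zero])
      have hm : m = -n := by
        have h2 := lam_apply_d_of_tpow_mem hz0 hly
        rw [LinearMap.neg_apply, affineWeight_d] at h2
        exact_mod_cast h2.symm
      subst hm
      refine ⟨z, hy, hz0, fun u => ?_⟩
      rw [lie_of_tpow_mem hly u, LinearMap.neg_apply, affineWeight_tpow]

lemma cartan_lie_cartan [IsLieAbelian H] {x y : Affine L} (hx : x ∈ cartan H)
    (hy : y ∈ cartan H) : ⁅x, y⁆ = 0 := by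
  obtain ⟨u, hu, hux⟩ := exists_of_mem_cartan hx
  obtain ⟨v, hv, hvy⟩ := exists_of_mem_cartan hy
  have huv : ⁅u, v⁆ = 0 := congrArg Subtype.val (trivial_lie_zero H H ⟨u, hu⟩ ⟨v, hv⟩)
  rw [hux, hvy]
  simp [lie_c, lie_d_tpow, c_lie, d_lie_tpow, lie_tpow, huv]

/-- In `[s + h, s + h]` the term `[h, h]` vanishes and the mixed terms lie in `s` by invariance.
Landing in `s`, not merely in `s + h`, is what later forces `[g, g] ⊆ s` when `s + h = g`. -/
lemma lie_mem_of_mem_sup_cartan [IsLieAbelian H] (hs : IsSymmetricRegular (cartan H) s)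
    {x y : Affine L} (hx : x ∈ s ⊔ (cartan H).toSubmodule) (hy : y ∈ s ⊔ (cartan H).toSubmodule) :
    ⁅x, y⁆ ∈ s := by
  obtain ⟨a, ha, b, hb, rfl⟩ := Submodule.mem_sup.1 hx
  obtain ⟨a', ha', b', hb', rfl⟩ := Submodule.mem_sup.1 hy
  rw [add_lie, lie_add, lie_add, cartan_lie_cartan hb hb', add_zero, ← lie_skew a b']
  exact add_mem (add_mem (hs.lie_mem _ ha _ ha') (neg_mem (hs.invariant _ hb' _ ha)))
    (hs.invariant _ hb _ ha')

/-- A vector of nonzero weight is a multiple of its bracket with an element of `h`, so shrinking `s`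
to a subspace that still contains `[h, s]` loses no root vector. -/
lemma rootsOf_eq_of_le [IsLieAbelian H] {s' : Submodule ℂ (Affine L)} (hss' : s' ≤ s)
    (h : ∀ x ∈ cartan H, ∀ y ∈ s, ⁅x, y⁆ ∈ s') :
    rootsOf (cartan H) s' = rootsOf (cartan H) s := by
  ext lam
  refine and_congr_right fun h0 => ?_
  have : weightSpace (cartan H) lam ⊓ s' = weightSpace (cartan H) lam ⊓ s := by
    refine le_antisymm (inf_le_inf_left _ hss') fun x hx => ⟨hx.1, ?_⟩
    obtain ⟨y, hy⟩ : ∃ y, lam y ≠ 0 := by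
      by_contra! h1
      exact h0.1 (LinearMap.ext h1)
    have hxy : x = (lam y)⁻¹ • ⁅(y : Affine L), x⁆ := by rw [hx.1 y, inv_smul_smul₀ hy]
    rw [hxy]
    exact s'.smul_mem _ (h _ y.2 _ hx.2)
  rw [this]

lemma IsSymmetricRegular.sup_cartan [IsLieAbelian H] (hs : IsSymmetricRegular (cartan H) s) :
    IsSymmetricRegular (cartan H) (s ⊔ (cartan H).toSubmodule) where
  lie_mem _ hx _ hy := le_sup_left (a := s) (lie_mem_of_mem_sup_cartan hs hx hy)
  invariant _ hx _ hy := le_sup_left (a := s) (lie_mem_of_mem_sup_cartan hs (le_sup_right (a := s) hx) hy)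
  symmetric := by
    rw [← rootsOf_eq_of_le le_sup_left fun x hx y hy =>
      lie_mem_of_mem_sup_cartan hs (le_sup_right (a := s) hx) hy]
    exact hs.symmetric

/-- The elements without `d`-component. -/
def degZero : Submodule ℂ (Affine L) where
  carrier := {x | x.deg = 0}
  add_mem' {x y} hx hy := by
    change x.deg + y.deg = 0
    rw [show x.deg = 0 from hx, show y.deg = 0 from hy, add_zero]
  zero_mem' := rfl
  smul_mem' r x hx := by
    change r * x.deg = 0
    rw [show x.deg = 0 from hx, mul_zero]

lemma degZero_ne_top : (degZero : Submodule ℂ (Affine L)) ≠ ⊤ := fun h => by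
  have : d L ∈ (degZero : Submodule ℂ (Affine L)) := h ▸ Submodule.mem_top
  exact one_ne_zero (show (1 : ℂ) = 0 from this)

/-- `degZero` is the kernel of a linear functional, hence a hyperplane. -/
lemma eq_degZero_of_le (h : degZero ≤ s) (hs : s ≠ ⊤) : s = degZero := by
  refine le_antisymm (fun x hx => ?_) h
  by_contra hx0
  refine hs (eq_top_iff.2 fun y _ => ?_)
  have h1 : y - (y.deg / x.deg) • x ∈ (degZero : Submodule ℂ (Affine L)) := by
    have : (y - (y.deg / x.deg) • x).deg = y.deg - (y.deg / x.deg) * x.deg := rfl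
    change (y - (y.deg / x.deg) • x).deg = 0
    rw [this, div_mul_cancel₀ _ hx0, sub_self]
  exact (s.sub_mem_iff_left (s.smul_mem _ hx)).1 (h h1)

lemma isSymmetricRegular_degZero [IsLieAbelian H]
    (h : IsSymmetricRegular (cartan H) (⊤ : Submodule ℂ (Affine L))) :
    IsSymmetricRegular (cartan H) degZero where
  lie_mem _ _ _ _ := rfl
  invariant _ _ _ _ := rfl
  symmetric := by
    rw [rootsOf_eq_of_le le_top fun _ _ _ _ => rfl]
    exact h.symmetric

end Family

/-! ### The derived algebra -/

section Derived

variable (L : Type*) [LieRing L] [LieAlgebra ℂ L] [FiniteDimensional ℂ L] [LieAlgebra.IsSimple ℂ L]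

/-- Nonzero degrees come from brackets with `d`, degree `0` from `[L, L] = L`, and `c` from `[x ⊗ t,
y ⊗ t⁻¹]` with `κ(x, y) ≠ 0`. -/
lemma lie_top_eq_degZero :
    (⁅(⊤ : LieIdeal ℂ (Affine L)), (⊤ : LieIdeal ℂ (Affine L))⁆ : LieIdeal ℂ (Affine L)).toSubmodule
      = degZero := by
  set I : LieIdeal ℂ (Affine L) := ⁅(⊤ : LieIdeal ℂ (Affine L)), (⊤ : LieIdeal ℂ (Affine L))⁆ with hI
  have hmem (x y : Affine L) : ⁅x, y⁆ ∈ I.toSubmodule :=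
    LieSubmodule.lie_mem_lie (LieSubmodule.mem_top x) (LieSubmodule.mem_top y)
  apply le_antisymm
  · rw [hI, LieSubmodule.lieIdeal_oper_eq_linear_span', Submodule.span_le]
    rintro _ ⟨x, -, y, -, rfl⟩
    rfl
  · have ht : ∀ n x, tpow L n x ∈ I.toSubmodule := by
      intro n x
      by_cases hn : n = 0
      · subst hn
        have hp : x ∈ (⁅(⊤ : LieIdeal ℂ L), (⊤ : LieIdeal ℂ L)⁆ : LieIdeal ℂ L) := by
          have := (LieAlgebra.IsSimple.eq_bot_or_eq_top
            (⁅(⊤ : LieIdeal ℂ L), (⊤ : LieIdeal ℂ L)⁆ : LieIdeal ℂ L)).resolve_left fun h =>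
              LieAlgebra.IsSimple.non_abelian ℂ (L := L) ⟨fun a b => by
                rw [← LieSubmodule.mem_bot (R := ℂ) (L := L), ← h]
                exact LieSubmodule.lie_mem_lie (LieSubmodule.mem_top a) (LieSubmodule.mem_top b)⟩
          rw [this]
          trivial
        rw [← LieSubmodule.mem_toSubmodule, LieSubmodule.lieIdeal_oper_eq_linear_span'] at hp
        induction hp using Submodule.span_induction with
        | mem x hx =>
          obtain ⟨a, -, b, -, rfl⟩ := hx
          have := hmem (tpow L 0 a) (tpow L 0 b)
          rw [lie_tpow] at this
          simpa using this
        | zero => simp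
        | add x y _ _ hx hy => rw [map_add]; exact add_mem hx hy
        | smul r x _ hx => rw [map_smul]; exact Submodule.smul_mem _ _ hx
      · have := hmem (d L) (tpow L n x)
        rw [d_lie_tpow] at this
        exact (Submodule.smul_mem_iff _ (Int.cast_ne_zero.2 hn)).1 this
    have hc : c L ∈ I.toSubmodule := by
      have hk : killingForm ℂ L ≠ 0 := by
        intro h0
        have h1 := LieAlgebra.IsKilling.ker_killingForm_eq_bot ℂ L
        rw [h0, LinearMap.ker_zero] at h1
        have h2 : Subsingleton L := (Submodule.subsingleton_iff ℂ).1 (subsingleton_of_bot_eq_top h1.symm)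
        exact LieAlgebra.IsSimple.non_abelian ℂ (L := L) ⟨fun _ _ => Subsingleton.elim _ _⟩
      obtain ⟨x, y, hxy⟩ : ∃ x y, killingForm ℂ L x y ≠ 0 := by
        by_contra! h
        exact hk (LinearMap.ext₂ h)
      have := hmem (tpow L 1 x) (tpow L (-1) y)
      rw [lie_tpow, Submodule.add_mem_iff_right _ (ht _ _), if_pos (by norm_num), Int.cast_one,
        one_mul] at this
      exact (Submodule.smul_mem_iff _ hxy).1 this
    intro x hx
    rw [eq_sum x, show x.deg = 0 from hx, zero_smul, add_zero]
    exact add_mem (sum_mem fun n _ => ht _ _) (Submodule.smul_mem _ _ hc)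

end Derived

/-! ### Root spaces of the finite-dimensional algebra -/

section Weights

variable {L : Type*} [LieRing L] [LieAlgebra ℂ L] [FiniteDimensional ℂ L] [LieAlgebra.IsSimple ℂ L]
  (H : LieSubalgebra ℂ L) [H.IsCartanSubalgebra]

/-- The root space of `χ`, as a subspace. -/
def rootSub (χ : H → ℂ) : Submodule ℂ L := (LieAlgebra.rootSpace H χ).toSubmodule

/-- The sum of the root spaces of the elements of `P`. -/
def sumRootSub (P : Set (H → ℂ)) : Submodule ℂ L := ⨆ χ ∈ P, rootSub H χ

variable {H} {χ ψ α β : H → ℂ} {N : Submodule ℂ L}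

/-- Root spaces are defined as generalised weight spaces; they are genuine ones because `H` acts
semisimply. -/
lemma mem_rootSub {x : L} : x ∈ rootSub H χ ↔ ∀ u : H, ⁅(u : L), x⁆ = χ u • x := by
  constructor
  · intro hx u
    exact LieAlgebra.IsKilling.lie_eq_smul_of_mem_rootSpace hx u
  · intro hx
    exact LieModule.weightSpace_le_genWeightSpace L χ ((LieModule.mem_weightSpace χ x).2 hx)

lemma lie_mem_rootSub {x y : L} (hx : x ∈ rootSub H χ) (hy : y ∈ rootSub H ψ) :
    ⁅x, y⁆ ∈ rootSub H (χ + ψ) :=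
  LieAlgebra.lie_mem_genWeightSpace_of_mem_genWeightSpace hx hy

lemma mem_rootSub_zero {x : L} : x ∈ rootSub H 0 ↔ x ∈ H := by
  change x ∈ LieAlgebra.rootSpace H 0 ↔ _
  rw [LieAlgebra.rootSpace_zero_eq, LieSubalgebra.mem_toLieSubmodule]

lemma iSupIndep_rootSub : iSupIndep (rootSub H) :=
  LieSubmodule.iSupIndep_toSubmodule.2 (LieModule.iSupIndep_genWeightSpace ℂ H L)

lemma rootSub_le_sumRootSub {P : Set (H → ℂ)} (h : χ ∈ P) : rootSub H χ ≤ sumRootSub H P :=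
  le_iSup₂_of_le χ h le_rfl

lemma sumRootSub_mono {P Q : Set (H → ℂ)} (h : P ⊆ Q) : sumRootSub H P ≤ sumRootSub H Q :=
  iSup₂_le fun _ hχ => rootSub_le_sumRootSub (h hχ)

lemma sumRootSub_induction {P : Set (H → ℂ)} {p : L → Prop} {x : L} (hx : x ∈ sumRootSub H P)
    (hm : ∀ χ ∈ P, ∀ x ∈ rootSub H χ, p x) (h0 : p 0) (ha : ∀ x y, p x → p y → p (x + y)) : p x := by
  rw [sumRootSub, iSup_subtype'] at hx
  exact Submodule.iSup_induction _ (motive := p) hx (fun χ x hx => hm χ χ.2 x hx) h0 ha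

lemma mem_of_mem_sumRootSub {P : Set (H → ℂ)} {x : L} (hx0 : x ≠ 0) (hx : x ∈ rootSub H χ)
    (hxP : x ∈ sumRootSub H P) : χ ∈ P := by
  by_contra h
  have h1 : sumRootSub H P ≤ ⨆ ψ, ⨆ _ : ψ ≠ χ, rootSub H ψ :=
    iSup₂_le fun ψ hψ => le_iSup₂_of_le ψ (fun e => h (e ▸ hψ)) le_rfl
  exact hx0 (Submodule.disjoint_def.1 (iSupIndep_rootSub χ) x hx (h1 hxP))

lemma rootSub_ne_bot_iff : rootSub H χ ≠ ⊥ ↔ ∃ w : LieModule.Weight ℂ H L, (w : H → ℂ) = χ := by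
  have h : rootSub H χ ≠ ⊥ ↔ LieAlgebra.rootSpace H χ ≠ ⊥ := (LieSubmodule.toSubmodule_eq_bot _).not
  rw [h]
  exact ⟨fun h => ⟨⟨χ, h⟩, rfl⟩, fun ⟨w, hw⟩ => hw ▸ w.genWeightSpace_ne_bot⟩

/-- An `H`-stable subspace is the sum of its intersections with the weight spaces, so inclusions can
be tested on weight vectors. -/
lemma le_of_forall_weight (hN : ∀ u ∈ H, ∀ x ∈ N, ⁅u, x⁆ ∈ N) {T : Submodule ℂ L}
    (h : ∀ w : LieModule.Weight ℂ H L, ∀ x ∈ N, x ∈ rootSub H w → x ∈ T) : N ≤ T := by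
  let N' : LieSubmodule ℂ H L := { N with lie_mem := fun {u x} hx => hN u u.2 x hx }
  have h1 := LieModule.eq_iSup_inf_genWeightSpace (K := ℂ) (L := H) (M := L) N'
  have h2 : N = ⨆ w : LieModule.Weight ℂ H L, N ⊓ rootSub H w := by
    have := congrArg LieSubmodule.toSubmodule h1
    rwa [LieSubmodule.iSup_toSubmodule] at this
  rw [h2]
  exact iSup_le fun w x hx => h w x hx.1 hx.2

lemma exists_smul_of_mem_rootSub (h0 : χ ≠ 0) {x y : L} (hx : x ∈ rootSub H χ)
    (hx0 : x ≠ 0) (hy : y ∈ rootSub H χ) : ∃ r : ℂ, r • x = y := by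
  obtain ⟨w, rfl⟩ := rootSub_ne_bot_iff.1 fun h => hx0 ((Submodule.eq_bot_iff _).1 h x hx)
  obtain ⟨r, hr⟩ := (finrank_eq_one_iff_of_nonzero' (⟨x, hx⟩ : LieAlgebra.rootSpace H w)
      (fun h => hx0 (congrArg Subtype.val h))).1
    (LieAlgebra.IsKilling.finrank_rootSpace_eq_one w h0) ⟨y, hy⟩
  exact ⟨r, congrArg Subtype.val hr⟩

lemma rootSub_le_of_mem (h0 : χ ≠ 0) {x : L} (hx : x ∈ rootSub H χ) (hx0 : x ≠ 0) (hxN : x ∈ N) :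
    rootSub H χ ≤ N := by
  intro y hy
  obtain ⟨r, rfl⟩ := exists_smul_of_mem_rootSub h0 hx hx0 hy
  exact N.smul_mem r hxN

/-- This is `[L_α, L_β] ≠ 0` whenever `α + β` is a weight, by `sl₂`-theory. With `v` at the top of
the `α`-string through `β`, up to nonzero scalars `x` is `e` and `y` is `f ^ (q + 1) v`, and `e f ^
(q + 1) v = (q + 1) (N - q) f ^ q v` with `N` the length of the string. -/
lemma lie_ne_zero_of_mem_rootSub (hα : α ≠ 0) (hβ : β ≠ 0) (hαβ : rootSub H (α + β) ≠ ⊥) {x y : L}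
    (hx : x ∈ rootSub H α) (hy : y ∈ rootSub H β) (hx0 : x ≠ 0) (hy0 : y ≠ 0) : ⁅x, y⁆ ≠ 0 := by
  obtain ⟨a, rfl⟩ := rootSub_ne_bot_iff.1 fun h => hx0 ((Submodule.eq_bot_iff _).1 h x hx)
  obtain ⟨b, rfl⟩ := rootSub_ne_bot_iff.1 fun h => hy0 ((Submodule.eq_bot_iff _).1 h y hy)
  have ha : a.IsNonZero := hα
  obtain ⟨v, hv, hv0⟩ := (LieModule.chainTop a b).exists_ne_zero
  obtain ⟨h, e, f, ht, he, hf⟩ := LieAlgebra.IsKilling.exists_isSl2Triple_of_weight_isNonZero ha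
  obtain rfl := ht.h_eq_coroot ha he hf
  have prim : ht.HasPrimitiveVectorWith v (LieAlgebra.IsKilling.chainLength a b : ℂ) :=
    have := LieAlgebra.lie_mem_genWeightSpace_of_mem_genWeightSpace he hv
    ⟨hv0, (LieAlgebra.IsKilling.chainLength_smul _ _ hv).symm, by
      rwa [LieModule.genWeightSpace_add_chainTop _ _ ha] at this⟩
  -- Since `α + β` is a weight, `β` is not the top of its string; this gives the form `q + 1`.
  have hp : 1 ≤ LieModule.chainTopCoeff a b := by
    have h1 : LieAlgebra.rootSpace H ((1 : ℤ) • (a : H → ℂ) + b) ≠ ⊥ := by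
      rw [one_smul]
      exact (LieSubmodule.toSubmodule_eq_bot _).not.1 hαβ
    have h2 := ((LieAlgebra.IsKilling.rootSpace_zsmul_add_ne_bot_iff a b ha 1).1 h1).1
    exact_mod_cast h2
  obtain ⟨q, hq⟩ := Nat.exists_eq_add_of_le' hp
  have hle : q + 1 ≤ LieAlgebra.IsKilling.chainLength a b :=
    hq ▸ LieAlgebra.IsKilling.chainTopCoeff_le_chainLength a b
  have hfv := LieAlgebra.toEnd_pow_apply_mem hf hv (q + 1)
  have hb : (q + 1) • (-(a : H → ℂ)) + LieModule.chainTop a b = b := by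
    rw [LieModule.coe_chainTop', hq]
    module
  rw [hb] at hfv
  obtain ⟨r, rfl⟩ := exists_smul_of_mem_rootSub hβ hfv
    (prim.pow_toEnd_f_ne_zero_of_eq_nat rfl hle) hy
  obtain ⟨r', rfl⟩ := exists_smul_of_mem_rootSub hα he ht.e_ne_zero hx
  rw [smul_lie, lie_smul, prim.lie_e_pow_succ_toEnd_f]
  refine smul_ne_zero (left_ne_zero_of_smul hx0) (smul_ne_zero (left_ne_zero_of_smul hy0)
    (smul_ne_zero (mul_ne_zero (by exact_mod_cast q.succ_ne_zero) (sub_ne_zero.2 ?_))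
      (prim.pow_toEnd_f_ne_zero_of_eq_nat rfl (by omega))))
  exact_mod_cast (by omega : LieAlgebra.IsKilling.chainLength a b ≠ q)

lemma root_rootSub_ne_bot (i : H.root) : rootSub H i.1 ≠ ⊥ := rootSub_ne_bot_iff.2 ⟨i.1, rfl⟩

lemma root_coe_ne_zero (i : H.root) : (i.1 : H → ℂ) ≠ 0 := H.isNonZero_coe_root i

lemma exists_root (h0 : χ ≠ 0) (h : rootSub H χ ≠ ⊥) : ∃ i : H.root, (i.1 : H → ℂ) = χ := by
  obtain ⟨w, rfl⟩ := rootSub_ne_bot_iff.1 h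
  exact ⟨⟨w, by simpa using h0⟩, rfl⟩

variable (H) in
-- Without roots `L` would equal `H` and be abelian.
lemma nonempty_root : Nonempty H.root := by
  by_contra h
  rw [not_nonempty_iff] at h
  have h1 : (⊤ : Submodule ℂ L) ≤ H.toSubmodule := by
    refine le_of_forall_weight (H := H) (fun _ _ _ _ => Submodule.mem_top) fun w x _ hx => ?_
    by_cases hw : (w : H → ℂ) = 0
    · rw [hw] at hx
      exact mem_rootSub_zero.1 hx
    · exact h.elim ⟨w, by simpa using hw⟩
  refine LieAlgebra.IsSimple.non_abelian ℂ (L := L) ⟨fun x y => ?_⟩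
  exact congrArg Subtype.val (trivial_lie_zero H H ⟨x, h1 trivial⟩ ⟨y, h1 trivial⟩)

lemma rootSub_neg_ne_bot (h : rootSub H χ ≠ ⊥) : rootSub H (-χ) ≠ ⊥ := by
  obtain ⟨w, rfl⟩ := rootSub_ne_bot_iff.1 h
  exact rootSub_ne_bot_iff.2 ⟨-w, LieModule.Weight.coe_neg⟩

/-- Reduces the axioms to combinatorics of weights. Independence of the root spaces is what makes a
weight vector in the sum over `P n` have its weight in `P n`. -/
lemma isSymmetricFamily_sumRootSub {P : ℤ → Set (H → ℂ)} (h0 : 0 ∈ P 0)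
    (hneg : ∀ n, ∀ χ ∈ P n, -χ ∈ P (-n))
    (hadd : ∀ m n, ∀ χ ∈ P m, ∀ ψ ∈ P n, rootSub H (χ + ψ) ≠ ⊥ → χ + ψ ∈ P (m + n)) :
    IsSymmetricFamily H fun n => sumRootSub H (P n) where
  lie_mem m n x hx y hy := by
    refine sumRootSub_induction (p := fun x => ⁅x, y⁆ ∈ sumRootSub H (P (m + n))) hx
      (fun χ hχ x hx => ?_) (by simp) (fun x x' h h' => by rw [add_lie]; exact add_mem h h')
    refine sumRootSub_induction (p := fun y => ⁅x, y⁆ ∈ sumRootSub H (P (m + n))) hy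
      (fun ψ hψ y hy => ?_) (by simp) (fun y y' h h' => by rw [lie_add]; exact add_mem h h')
    have hxy := lie_mem_rootSub hx hy
    by_cases hb : rootSub H (χ + ψ) = ⊥
    · rw [hb, Submodule.mem_bot] at hxy
      rw [hxy]
      exact zero_mem _
    · exact rootSub_le_sumRootSub (hadd m n χ hχ ψ hψ hb) hxy
  cartan_le u hu := rootSub_le_sumRootSub h0 (mem_rootSub_zero.2 hu)
  symmetric α n := by
    rintro ⟨x, hx, hx0, hxα⟩
    have hxα' : x ∈ rootSub H α := mem_rootSub.2 hxα
    have h1 : rootSub H α ≠ ⊥ := fun h => hx0 ((Submodule.eq_bot_iff _).1 h x hxα')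
    obtain ⟨y, hy, hy0⟩ := Submodule.exists_mem_ne_zero_of_ne_bot (rootSub_neg_ne_bot h1)
    exact ⟨y, rootSub_le_sumRootSub (hneg n _ (mem_of_mem_sumRootSub hx0 hxα' hx)) hy, hy0,
      mem_rootSub.1 hy⟩

end Weights

/-! ### The gradient and the linear degree function -/

section Classification

variable {L : Type*} [LieRing L] [LieAlgebra ℂ L] [FiniteDimensional ℂ L] [LieAlgebra.IsSimple ℂ L]
  {H : LieSubalgebra ℂ L} [H.IsCartanSubalgebra] {S : ℤ → Submodule ℂ L} {χ ψ α β : H → ℂ}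

namespace IsSymmetricFamily

variable (hS : IsSymmetricFamily H S)
include hS

lemma lie_mem_of_mem_cartan (n : ℤ) {u x : L} (hu : u ∈ H) (hx : x ∈ S n) : ⁅u, x⁆ ∈ S n := by
  have := hS.lie_mem 0 n u (hS.cartan_le hu) x hx
  rwa [zero_add] at this

lemma rootSub_add_le {m n : ℤ} (hα : α ≠ 0) (hβ : β ≠ 0) (hαβ : α + β ≠ 0)
    (hα' : rootSub H α ≠ ⊥) (hβ' : rootSub H β ≠ ⊥) (hm : rootSub H α ≤ S m)
    (hn : rootSub H β ≤ S n) : rootSub H (α + β) ≤ S (m + n) := by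
  by_cases hb : rootSub H (α + β) = ⊥
  · rw [hb]; exact bot_le
  obtain ⟨x, hx, hx0⟩ := Submodule.exists_mem_ne_zero_of_ne_bot hα'
  obtain ⟨y, hy, hy0⟩ := Submodule.exists_mem_ne_zero_of_ne_bot hβ'
  exact rootSub_le_of_mem hαβ (lie_mem_rootSub hx hy)
    (lie_ne_zero_of_mem_rootSub hα hβ hb hx hy hx0 hy0) (hS.lie_mem m n x (hm hx) y (hn hy))

lemma exists_mem_rootSub_neg {n : ℤ} {x : L} (hx : x ∈ S n) (hx0 : x ≠ 0)
    (hxα : x ∈ rootSub H α) : ∃ y ∈ S (-n), y ≠ 0 ∧ y ∈ rootSub H (-α) := by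
  obtain ⟨w, rfl⟩ := rootSub_ne_bot_iff.1 fun h => hx0 ((Submodule.eq_bot_iff _).1 h x hxα)
  obtain ⟨y, hy, hy0, hyu⟩ := hS.symmetric w.toLinear n ⟨x, hx, hx0, mem_rootSub.1 hxα⟩
  exact ⟨y, hy, hy0, mem_rootSub.2 hyu⟩

lemma rootSub_neg_le {n : ℤ} (hα : α ≠ 0) (hα' : rootSub H α ≠ ⊥) (h : rootSub H α ≤ S n) :
    rootSub H (-α) ≤ S (-n) := by
  obtain ⟨x, hx, hx0⟩ := Submodule.exists_mem_ne_zero_of_ne_bot hα'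
  obtain ⟨y, hy, hy0, hyα⟩ := hS.exists_mem_rootSub_neg (h hx) hx0 hx
  exact rootSub_le_of_mem (neg_ne_zero.2 hα) hyα hy0 hy

/-- Root strings are unbroken, so one can climb by `a` one step at a time. The hypothesis on `b`
keeps the string away from `0`, whose weight space `H` need not be one-dimensional. -/
lemma rootSub_add_nsmul_le {a b : LieModule.Weight ℂ H L} (ha : a.IsNonZero)
    (hb : ∀ c : ℤ, (b : H → ℂ) ≠ c • (a : H → ℂ)) {m n : ℤ} (hm : rootSub H a ≤ S m)
    (hn : rootSub H b ≤ S n) (j : ℕ) (hj : LieAlgebra.rootSpace H ((j : ℤ) • (a : H → ℂ) + b) ≠ ⊥) :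
    rootSub H ((j : ℤ) • (a : H → ℂ) + b) ≤ S (j * m + n) := by
  have hne (j : ℤ) : j • (a : H → ℂ) + b ≠ 0 := fun h =>
    hb (-j) (by rw [neg_smul]; exact eq_neg_of_add_eq_zero_right h)
  induction j with
  | zero => simpa using hn
  | succ j ih =>
    have h1 : LieAlgebra.rootSpace H ((j : ℤ) • (a : H → ℂ) + b) ≠ ⊥ := by
      rw [LieAlgebra.IsKilling.rootSpace_zsmul_add_ne_bot_iff a b ha] at hj ⊢
      omega
    have h2 := hS.rootSub_add_le ha (hne j)
      (by have := hne (j + 1); rwa [add_smul, one_smul, add_comm _ (a : H → ℂ), add_assoc] at this)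
      (rootSub_ne_bot_iff.2 ⟨a, rfl⟩) ((LieSubmodule.toSubmodule_eq_bot _).not.2 h1) hm (ih h1)
    convert h2 using 2
    · push_cast; rw [add_smul, one_smul]; abel
    · push_cast; ring

omit hS in
variable (H S) in
/-- The set of the roots whose root space occurs in some degree. -/
def gradient : Set H.root := {i | ∃ n, rootSub H i.1 ≤ S n}

lemma isClosedSubroot_gradient : IsClosedSubroot H (gradient H S) where
  add_mem i hi j hj k hk := by
    obtain ⟨m, hm⟩ := hi
    obtain ⟨n, hn⟩ := hj
    have hk' : (k.1 : H → ℂ) = i.1 + j.1 := congrArg DFunLike.coe hk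
    refine ⟨m + n, ?_⟩
    rw [hk']
    exact hS.rootSub_add_le (root_coe_ne_zero i) (root_coe_ne_zero j)
      (hk' ▸ root_coe_ne_zero k) (root_rootSub_ne_bot i) (root_rootSub_ne_bot j) hm hn
  reflection_mem i hi j hj := by
    obtain ⟨m, hm⟩ := hi
    obtain ⟨n, hn⟩ := hj
    set k := (LieAlgebra.IsKilling.rootSystem H).reflectionPerm i j
    have ha : i.1.IsNonZero := root_coe_ne_zero i
    have hk : (k.1 : H → ℂ) = j.1 - (j.1 (LieAlgebra.IsKilling.coroot i.1)) • (i.1 : H → ℂ) := by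
      have h1 := (LieAlgebra.IsKilling.rootSystem H).root_reflectionPerm i j
      rw [RootPairing.reflection_apply_root] at h1
      exact congrArg DFunLike.coe h1
    have hkb := root_rootSub_ne_bot k
    -- If `j` is a multiple of `i`, the reflection sends it to `-j`, and symmetry suffices.
    by_cases hb : ∃ c : ℤ, (j.1 : H → ℂ) = c • (i.1 : H → ℂ)
    · obtain ⟨c, hc⟩ := hb
      have h2 : (j.1 : H → ℂ) = (c : ℂ) • (i.1 : H → ℂ) := by rw [hc, Int.cast_smul_eq_zsmul]
      have h3 : (k.1 : H → ℂ) = -j.1 := by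
        have h4 : j.1 (LieAlgebra.IsKilling.coroot i.1) = (c : ℂ) * 2 := by
          rw [congrFun h2, Pi.smul_apply, LieAlgebra.IsKilling.root_apply_coroot ha, smul_eq_mul]
        rw [hk, h4, h2]
        module
      refine ⟨-n, ?_⟩
      rw [h3]
      exact hS.rootSub_neg_le (root_coe_ne_zero j) (root_rootSub_ne_bot j) hn
    · push Not at hb
      obtain ⟨z, hz⟩ : ∃ z : ℤ, j.1 (LieAlgebra.IsKilling.coroot i.1) = (z : ℂ) :=
        ⟨_, LieAlgebra.IsKilling.apply_coroot_eq_cast i.1 j.1⟩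
      rw [hz, Int.cast_smul_eq_zsmul] at hk
      -- The reflected root is `j - z i`: it is reached by climbing along `i` when `z ≤ 0` and along
      -- `-i` when `z ≥ 0`.
      rcases le_total z 0 with h0 | h0
      · obtain ⟨q, hq⟩ := Int.eq_ofNat_of_zero_le (neg_nonneg.2 h0)
        have hk2 : (k.1 : H → ℂ) = (q : ℤ) • (i.1 : H → ℂ) + j.1 := by
          rw [hk, ← hq]; module
        refine ⟨q * m + n, ?_⟩
        rw [hk2] at hkb ⊢
        exact hS.rootSub_add_nsmul_le ha hb hm hn q ((LieSubmodule.toSubmodule_eq_bot _).not.1 hkb)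
      · obtain ⟨q, hq⟩ := Int.eq_ofNat_of_zero_le h0
        have hk2 : (k.1 : H → ℂ) = (q : ℤ) • ((-i.1 : LieModule.Weight ℂ H L) : H → ℂ) + j.1 := by
          rw [hk, ← hq, LieModule.Weight.coe_neg]; module
        refine ⟨q * (-m) + n, ?_⟩
        rw [hk2] at hkb ⊢
        refine hS.rootSub_add_nsmul_le ha.neg (fun c hc => hb (-c) ?_)
          (hS.rootSub_neg_le (root_coe_ne_zero i) (root_rootSub_ne_bot i) hm) hn q
          ((LieSubmodule.toSubmodule_eq_bot _).not.1 hkb)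
        rw [hc, LieModule.Weight.coe_neg]
        module

/-- The arbitrary degrees `f` are kept only on a base, where they determine `F`. Every root is
reached from simple roots by negation and by adding simple roots, and both operations preserve the
claim. Off the base `f` and `F` may differ. -/
lemma exists_linear (h : gradient H S = Set.univ) :
    ∃ F : Submodule.span ℤ (Set.range (LieAlgebra.IsKilling.rootSystem H).root) →ₗ[ℤ] ℤ,
      ∀ i : H.root, rootSub H i.1 ≤ S (F ⟨(LieAlgebra.IsKilling.rootSystem H).root i,
        Submodule.subset_span (Set.mem_range_self i)⟩) := by
  have h' (i : H.root) : ∃ n, rootSub H i.1 ≤ S n := (h ▸ Set.mem_univ i : i ∈ gradient H S)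
  choose f hf using h'
  obtain ⟨b⟩ := (LieAlgebra.IsKilling.rootSystem H).nonempty_base
  let F : Submodule.span ℤ (Set.range (LieAlgebra.IsKilling.rootSystem H).root) →ₗ[ℤ] ℤ :=
    b.toWeightBasisInt.constr ℤ fun i => f i
  have hF (i : H.root) (hi : i ∈ b.support) : F ⟨(LieAlgebra.IsKilling.rootSystem H).root i,
      Submodule.subset_span (Set.mem_range_self i)⟩ = f i := by
    have h1 := b.toWeightBasisInt.constr_basis ℤ (fun i : b.support => f i) ⟨i, hi⟩
    have h2 : b.toWeightBasisInt ⟨i, hi⟩ = ⟨(LieAlgebra.IsKilling.rootSystem H).root i,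
      Submodule.subset_span (Set.mem_range_self i)⟩ :=
      Subtype.ext (b.coe_toWeightBasisInt_apply ⟨i, hi⟩)
    rw [← h1, h2]
  refine ⟨F, fun i => ?_⟩
  refine b.induction_add (p := fun i => rootSub H i.1 ≤
    S (F ⟨(LieAlgebra.IsKilling.rootSystem H).root i,
        Submodule.subset_span (Set.mem_range_self i)⟩)) i ?_ ?_ ?_
  · intro i hi
    have h1 : (LieAlgebra.IsKilling.rootSystem H).root
        ((LieAlgebra.IsKilling.rootSystem H).reflectionPerm i i) =
        -(LieAlgebra.IsKilling.rootSystem H).root i := by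
      rw [RootPairing.root_reflectionPerm, RootPairing.reflection_apply_self]
    have h2 := hS.rootSub_neg_le (root_coe_ne_zero i) (root_rootSub_ne_bot i) hi
    rw [← map_neg] at h2
    convert h2 using 1
    · exact congrArg (rootSub H) (congrArg DFunLike.coe h1)
    · congr 2
      exact Subtype.ext h1
  · intro i hi
    rw [hF i hi]
    exact hf i
  · intro i j k hk hi hj
    have hk' : (k.1 : H → ℂ) = i.1 + j.1 := congrArg DFunLike.coe hk
    have h2 := hS.rootSub_add_le (root_coe_ne_zero i) (root_coe_ne_zero j)
      (hk' ▸ root_coe_ne_zero k) (root_rootSub_ne_bot i) (root_rootSub_ne_bot j) hi (hf j)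
    rw [← hF j hj, ← map_add] at h2
    rw [hk']
    convert h2 using 2
    congr 1
    exact Subtype.ext hk

end IsSymmetricFamily

end Classification

/-! ### Families with full gradient -/

section Congruence

variable {L : Type*} [LieRing L] [LieAlgebra ℂ L] [FiniteDimensional ℂ L] [LieAlgebra.IsSimple ℂ L]
  (H : LieSubalgebra ℂ L) [H.IsCartanSubalgebra]

/-- The root lattice. -/
abbrev rootLattice : Submodule ℤ (Module.Dual ℂ H) :=
  Submodule.span ℤ (Set.range (LieAlgebra.IsKilling.rootSystem H).root)

variable {H}

/-- The weights that occur in each degree of the gradient subspace of `Ψ`. -/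
def gradientWeights (Ψ : Set H.root) : Set (H → ℂ) :=
  insert 0 {χ | ∃ i ∈ Ψ, (i.1 : H → ℂ) = χ}

/-- The elements of the root lattice that occur in degree `n` of the congruence subspace of `k` and
`F`. -/
def congruenceWeights (k : ℕ) (F : rootLattice H →ₗ[ℤ] ℤ) (n : ℤ) : Set (H → ℂ) :=
  {χ | ∃ x : rootLattice H, ⇑(x : Module.Dual ℂ H) = χ ∧ (k : ℤ) ∣ n - F x}

/-- A root as an element of the root lattice. -/
def latticeRoot (i : H.root) : rootLattice H :=
  ⟨(LieAlgebra.IsKilling.rootSystem H).root i, Submodule.subset_span (Set.mem_range_self i)⟩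

lemma exists_lattice_eq (w : LieModule.Weight ℂ H L) :
    ∃ x : rootLattice H, ⇑(x : Module.Dual ℂ H) = w := by
  by_cases hw : (w : H → ℂ) = 0
  · exact ⟨0, hw.symm⟩
  · exact ⟨latticeRoot ⟨w, by simpa using hw⟩, rfl⟩

lemma lattice_coe_injective :
    Function.Injective fun x : rootLattice H => ⇑(x : Module.Dual ℂ H) :=
  fun _ _ h => Subtype.ext (DFunLike.coe_injective h)

lemma isSymmetricFamily_gradientWeights {Ψ : Set H.root} (hΨ : IsClosedSubroot H Ψ) :
    IsSymmetricFamily H fun _ => sumRootSub H (gradientWeights Ψ) := by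
  have hneg : ∀ i ∈ Ψ, ∀ j : H.root, (j.1 : H → ℂ) = -i.1 → j ∈ Ψ := by
    intro i hi j hj
    have h1 := hΨ.reflection_mem i hi i hi
    convert h1
    apply (LieAlgebra.IsKilling.rootSystem H).root.injective
    rw [RootPairing.root_reflectionPerm, RootPairing.reflection_apply_self]
    exact DFunLike.coe_injective hj
  refine isSymmetricFamily_sumRootSub (P := fun _ => gradientWeights Ψ) (Or.inl rfl) ?_ ?_
  · rintro - χ (rfl | ⟨i, hi, rfl⟩)
    · exact Or.inl neg_zero
    · obtain ⟨j, hj⟩ := exists_root (neg_ne_zero.2 (root_coe_ne_zero i))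
        (rootSub_neg_ne_bot (root_rootSub_ne_bot i))
      exact Or.inr ⟨j, hneg i hi j hj, hj⟩
  · rintro - - χ (rfl | ⟨i, hi, rfl⟩) ψ (rfl | ⟨j, hj, rfl⟩) hb
    · exact Or.inl (add_zero _)
    · rw [zero_add]; exact Or.inr ⟨j, hj, rfl⟩
    · rw [add_zero]; exact Or.inr ⟨i, hi, rfl⟩
    · by_cases h0 : (i.1 : H → ℂ) + j.1 = 0
      · exact Or.inl h0
      · obtain ⟨k, hk⟩ := exists_root h0 hb
        exact Or.inr ⟨k, hΨ.add_mem i hi j hj k (DFunLike.coe_injective hk), hk⟩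

lemma isSymmetricFamily_congruenceWeights (k : ℕ) (F : rootLattice H →ₗ[ℤ] ℤ) :
    IsSymmetricFamily H fun n => sumRootSub H (congruenceWeights k F n) := by
  refine isSymmetricFamily_sumRootSub ⟨0, rfl, by simp⟩ ?_ ?_
  · rintro n χ ⟨x, rfl, hx⟩
    refine ⟨-x, rfl, ?_⟩
    rw [map_neg, ← dvd_neg, show -(-n - -F x) = n - F x by ring]
    exact hx
  · rintro m n χ ⟨x, rfl, hx⟩ ψ ⟨y, rfl, hy⟩ -
    refine ⟨x + y, rfl, ?_⟩
    rw [map_add, show m + n - (F x + F y) = m - F x + (n - F y) by ring]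
    exact dvd_add hx hy

lemma zero_mem_congruenceWeights {k : ℕ} {F : rootLattice H →ₗ[ℤ] ℤ} {n : ℤ} :
    0 ∈ congruenceWeights k F n ↔ (k : ℤ) ∣ n := by
  constructor
  · rintro ⟨x, hx, hxn⟩
    have : x = 0 := lattice_coe_injective hx
    rwa [this, map_zero, sub_zero] at hxn
  · exact fun h => ⟨0, rfl, by rwa [map_zero, sub_zero]⟩

/-- If subspaces of independent summands already span everything, none of them can be smaller than
its summand. -/
lemma le_of_iSupIndep_of_iSup_eq_top {ι : Type*} {M : Type*} [AddCommGroup M] [Module ℂ M]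
    {f g : ι → Submodule ℂ M} (hf : iSupIndep f) (hg : ∀ i, g i ≤ f i) (h : ⨆ i, g i = ⊤) (i : ι) :
    f i ≤ g i := by
  intro x hx
  have h1 : x ∈ g i ⊔ ⨆ j, ⨆ _ : j ≠ i, g j := by
    have : (⊤ : Submodule ℂ M) ≤ g i ⊔ ⨆ j, ⨆ _ : j ≠ i, g j := by
      rw [← h]
      refine iSup_le fun j => ?_
      by_cases hj : j = i
      · rw [hj]; exact le_sup_left
      · exact le_sup_of_le_right (le_iSup₂_of_le j hj le_rfl)
    exact this Submodule.mem_top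
  obtain ⟨a, ha, b, hb, rfl⟩ := Submodule.mem_sup.1 h1
  have h2 : b = 0 := by
    refine Submodule.disjoint_def.1 (hf i) b ((Submodule.add_mem_iff_right _ (hg i ha)).1 hx) ?_
    exact iSup₂_mono (fun j _ => hg j) hb
  rwa [h2, add_zero]

namespace IsSymmetricFamily

variable {S : ℤ → Submodule ℂ L} (hS : IsSymmetricFamily H S) {F : rootLattice H →ₗ[ℤ] ℤ}
  (hF : ∀ i : H.root, rootSub H i.1 ≤ S (F (latticeRoot i)))
include hS

lemma le_gradient (n : ℤ) : S n ≤ sumRootSub H (gradientWeights (gradient H S)) := by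
  refine le_of_forall_weight (fun u hu x hx => hS.lie_mem_of_mem_cartan n hu hx) fun w x hx hxw => ?_
  by_cases hx0 : x = 0
  · rw [hx0]; exact zero_mem _
  refine rootSub_le_sumRootSub ?_ hxw
  by_cases hw : (w : H → ℂ) = 0
  · exact Or.inl hw
  · exact Or.inr ⟨⟨w, by simpa using hw⟩, ⟨n, rootSub_le_of_mem hw hxw hx0 hx⟩, rfl⟩

include hF

/-- Indexing by the whole root lattice treats roots, `0` and non-weights uniformly; non-weights have
zero root space. -/
lemma rootSub_lattice_le (x : rootLattice H) : rootSub H (x : Module.Dual ℂ H) ≤ S (F x) := by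
  by_cases hb : rootSub H (x : Module.Dual ℂ H) = ⊥
  · rw [hb]; exact bot_le
  by_cases h0 : ((x : Module.Dual ℂ H) : H → ℂ) = 0
  · have hx : x = 0 := lattice_coe_injective h0
    intro y hy
    rw [h0, mem_rootSub_zero] at hy
    rw [hx, map_zero]
    exact hS.cartan_le hy
  · obtain ⟨i, hi⟩ := exists_root h0 hb
    have hx : latticeRoot i = x := lattice_coe_injective hi
    rw [← hi, ← hx]
    exact hF i

/-- After untwisting by `F`, each shift `n` is all or nothing. Since `L_v ⊆ S (F v)`, bracketing
with `L_v` maps `g x` into `g (v + x)`; hence `⨆ x, g x` is an ideal of the simple algebra `L`, and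
one nonzero vector makes it everything. -/
lemma rootSub_le_of_exists_mem {n : ℤ} {x : rootLattice H} {y : L} (hy0 : y ≠ 0)
    (hyx : y ∈ rootSub H (x : Module.Dual ℂ H)) (hy : y ∈ S (n + F x)) (z : rootLattice H) :
    rootSub H (z : Module.Dual ℂ H) ≤ S (n + F z) := by
  let g (x : rootLattice H) : Submodule ℂ L := rootSub H (x : Module.Dual ℂ H) ⊓ S (n + F x)
  have hlie : ∀ a : L, ∀ b ∈ ⨆ x, g x, ⁅a, b⁆ ∈ ⨆ x, g x := by
    intro a b hb
    refine Submodule.iSup_induction _ (motive := fun b => ⁅a, b⁆ ∈ ⨆ x, g x) hb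
      (fun x b hb => ?_) (by simp) (fun b b' h h' => by rw [lie_add]; exact add_mem h h')
    have ha : a ∈ ⨆ w : LieModule.Weight ℂ H L, rootSub H w := by
      have := LieModule.iSup_genWeightSpace_eq_top' ℂ H L
      rw [← LieSubmodule.toSubmodule_inj, LieSubmodule.iSup_toSubmodule] at this
      exact this.symm ▸ Submodule.mem_top
    refine Submodule.iSup_induction _ (motive := fun a => ⁅a, b⁆ ∈ ⨆ x, g x) ha
      (fun w a ha => ?_) (by simp) (fun a a' h h' => by rw [add_lie]; exact add_mem h h')
    obtain ⟨v, hv⟩ := exists_lattice_eq w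
    rw [← hv] at ha
    refine Submodule.mem_iSup_of_mem (v + x) ⟨lie_mem_rootSub ha hb.1, ?_⟩
    have := hS.lie_mem _ _ _ (hS.rootSub_lattice_le hF v ha) _ hb.2
    rwa [map_add, add_left_comm]
  let I : LieIdeal ℂ L := { ⨆ x, g x with lie_mem := fun {a b} hb => hlie a b hb }
  have hI : I = ⊤ := (LieAlgebra.IsSimple.eq_bot_or_eq_top I).resolve_left fun h => by
    have : y ∈ I := (le_iSup g x) ⟨hyx, hy⟩
    rw [h, LieSubmodule.mem_bot] at this
    exact hy0 this
  have hg : ⨆ x, g x = ⊤ := congrArg LieSubmodule.toSubmodule hI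
  have hind : iSupIndep fun x : rootLattice H => rootSub H (x : Module.Dual ℂ H) :=
    iSupIndep_rootSub.comp lattice_coe_injective
  exact (le_of_iSupIndep_of_iSup_eq_top hind (fun _ => inf_le_left) hg z).trans inf_le_right

/-- The full shifts form a subgroup `K` of `ℤ`, and `k` generates it. The value `k = 0` is possible:
then each `L_x` occurs only in degree `F x`. -/
lemma exists_eq_sumRootSub_congruenceWeights :
    ∃ k : ℕ, ∀ n, S n = sumRootSub H (congruenceWeights k F n) := by
  obtain ⟨i⟩ := nonempty_root H
  obtain ⟨y, hy, hy0⟩ := Submodule.exists_mem_ne_zero_of_ne_bot (root_rootSub_ne_bot i)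
  obtain ⟨u, hu⟩ : ∃ u, i.1 u ≠ 0 := by
    by_contra! h
    exact root_coe_ne_zero i (funext h)
  let K : AddSubgroup ℤ :=
    { carrier := {n | ∀ x : rootLattice H, rootSub H (x : Module.Dual ℂ H) ≤ S (n + F x)}
      zero_mem' := fun x => by rw [zero_add]; exact hS.rootSub_lattice_le hF x
      add_mem' := by
        intro m n hm hn
        refine hS.rootSub_le_of_exists_mem hF (x := latticeRoot i) hy0 hy ?_
        -- A full shift `m` contains `H ⊗ t ^ m`. Bracketing with `u`, on which the root `i` does
        -- not vanish, carries a root vector from shift `n` to shift `m + n`.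
        have h1 : (u : L) ∈ S m := by
          have := hm 0 (mem_rootSub_zero.2 u.2)
          rwa [map_zero, add_zero] at this
        have h2 := hS.lie_mem _ _ _ h1 _ (hn (latticeRoot i) hy)
        rw [mem_rootSub.1 hy u, Submodule.smul_mem_iff _ hu] at h2
        rwa [add_assoc]
      neg_mem' := by
        intro n hn
        obtain ⟨z, hz, hz0, hzi⟩ := hS.exists_mem_rootSub_neg (hn (latticeRoot i) hy) hy0 hy
        refine hS.rootSub_le_of_exists_mem hF (x := -latticeRoot i) hz0 hzi ?_
        rwa [map_neg, ← neg_add] }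
  obtain ⟨a, ha⟩ := Int.subgroup_cyclic K
  have hK (n : ℤ) : n ∈ K ↔ ((a.natAbs : ℕ) : ℤ) ∣ n := by
    rw [ha, AddSubgroup.mem_closure_singleton, Int.natAbs_dvd]
    refine exists_congr fun r => ?_
    rw [smul_eq_mul, mul_comm, eq_comm]
  refine ⟨a.natAbs, fun n => le_antisymm ?_ ?_⟩
  · refine le_of_forall_weight (fun u hu x hx => hS.lie_mem_of_mem_cartan n hu hx) fun w x hx hxw => ?_
    by_cases hx0 : x = 0
    · rw [hx0]; exact zero_mem _
    obtain ⟨v, hv⟩ := exists_lattice_eq w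
    rw [← hv] at hxw
    have hn : n - F v ∈ K :=
      hS.rootSub_le_of_exists_mem hF hx0 hxw (by rwa [sub_add_cancel])
    exact rootSub_le_sumRootSub (P := congruenceWeights _ F n) ⟨v, rfl, (hK _).1 hn⟩ hxw
  · refine iSup₂_le ?_
    rintro χ ⟨x, rfl, hx⟩
    have := (hK _).2 hx x
    rwa [sub_add_cancel] at this

end IsSymmetricFamily

end Congruence

/-! ### Maximality -/

section Maximal

variable {L : Type*} [LieRing L] [LieAlgebra ℂ L] [FiniteDimensional ℂ L] [LieAlgebra.IsSimple ℂ L]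
  {H : LieSubalgebra ℂ L} [H.IsCartanSubalgebra]

lemma map_tpow_sumRootSub_le {P : Set (H → ℂ)} {n : ℤ} {s : Submodule ℂ (Affine L)}
    (h : ∀ χ ∈ P, (rootSub H χ).map (tpow L n) ≤ s) {x : L} (hx : x ∈ sumRootSub H P) :
    tpow L n x ∈ s :=
  sumRootSub_induction (p := fun x => tpow L n x ∈ s) hx
    (fun χ hχ _ hx => h χ hχ (Submodule.mem_map_of_mem hx)) (by rw [map_zero]; exact zero_mem _)
    (fun _ _ hx hy => by rw [map_add]; exact add_mem hx hy)

lemma cartanTpow_eq (n : ℤ) : cartanTpow H n = (rootSub H 0).map (tpow L n) := by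
  rw [show rootSub H 0 = H.toSubmodule from Submodule.ext fun _ => mem_rootSub_zero]
  rfl

lemma map_tpow_le_ofFamily {S : ℤ → Submodule ℂ L} {N : Submodule ℂ L} {n : ℤ} (h : N ≤ S n) :
    N.map (tpow L n) ≤ ofFamily S := by
  rintro _ ⟨x, hx, rfl⟩
  exact tpow_mem_ofFamily.2 (h hx)

lemma gradientSubspace_eq (Ψ : Set H.root) :
    gradientSubspace H Ψ = ofFamily fun _ => sumRootSub H (gradientWeights Ψ) := by
  have h0 : rootSub H 0 ≤ sumRootSub H (gradientWeights Ψ) := rootSub_le_sumRootSub (Or.inl rfl)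
  apply le_antisymm
  · refine sup_le (sup_le ?_ (iSup₂_le fun i hi => iSup_le fun r => ?_))
      (iSup₂_le fun r _ => ?_)
    · exact Affine.cartan_le (fun u hu => tpow_mem_ofFamily.2 (h0 (mem_rootSub_zero.2 hu)))
        c_mem_ofFamily d_mem_ofFamily
    · exact map_tpow_le_ofFamily (rootSub_le_sumRootSub (Or.inr ⟨i, hi, rfl⟩))
    · rw [cartanTpow_eq]
      exact map_tpow_le_ofFamily h0
  · have hc : (cartan H).toSubmodule ≤ gradientSubspace H Ψ := le_sup_of_le_left le_sup_left
    refine ofFamily_le (fun n x hx => map_tpow_sumRootSub_le ?_ hx) (hc (c_mem_cartan H))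
      (hc (d_mem_cartan H))
    rintro χ (rfl | ⟨i, hi, rfl⟩)
    · by_cases hn : n = 0
      · subst hn
        rintro _ ⟨x, hx, rfl⟩
        exact hc (tpow_zero_mem_cartan H (mem_rootSub_zero.1 hx))
      · rw [← cartanTpow_eq]
        exact le_sup_of_le_right (le_iSup₂_of_le n hn le_rfl)
    · exact le_sup_of_le_left (le_sup_of_le_right (le_iSup₂_of_le i hi (le_iSup_of_le n le_rfl)))

lemma congruenceSubspace_sup_eq (k : ℕ) (F : rootLattice H →ₗ[ℤ] ℤ) {f : H.root → ℤ}
    (hf : ∀ i, f i = F (latticeRoot i)) :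
    congruenceSubspace H k f ⊔ Submodule.span ℂ {d L} =
      ofFamily fun n => sumRootSub H (congruenceWeights k F n) := by
  apply le_antisymm
  · refine sup_le (sup_le (sup_le (iSup₂_le fun i r => ?_) (iSup_le fun r => ?_)) ?_) ?_
    · refine map_tpow_le_ofFamily (rootSub_le_sumRootSub ⟨latticeRoot i, rfl, ?_⟩)
      rw [hf, add_sub_cancel_left]
      exact dvd_mul_right _ _
    · rw [cartanTpow_eq]
      exact map_tpow_le_ofFamily
        (rootSub_le_sumRootSub (zero_mem_congruenceWeights.2 (dvd_mul_right _ _)))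
    · rw [Submodule.span_singleton_le_iff_mem]
      exact c_mem_ofFamily
    · rw [Submodule.span_singleton_le_iff_mem]
      exact d_mem_ofFamily
  · have hc : c L ∈ congruenceSubspace H k f :=
      Submodule.mem_sup_right (Submodule.mem_span_singleton_self _)
    refine ofFamily_le (fun n x hx => map_tpow_sumRootSub_le ?_ hx) (Submodule.mem_sup_left hc)
      (Submodule.mem_sup_right (Submodule.mem_span_singleton_self _))
    rintro _ ⟨y, rfl, hy⟩
    by_cases hb : rootSub H (y : Module.Dual ℂ H) = ⊥
    · rw [hb, Submodule.map_bot]; exact bot_le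
    by_cases h0 : ((y : Module.Dual ℂ H) : H → ℂ) = 0
    · have hy0 : y = 0 := lattice_coe_injective h0
      rw [h0, ← cartanTpow_eq]
      rw [hy0, map_zero, sub_zero] at hy
      obtain ⟨r, rfl⟩ := hy
      exact le_sup_of_le_left (le_sup_of_le_left (le_sup_of_le_right (le_iSup_of_le r le_rfl)))
    · obtain ⟨i, hi⟩ := exists_root h0 hb
      have hiy : latticeRoot i = y := lattice_coe_injective hi
      rw [← hiy, ← hf] at hy
      obtain ⟨r, hr⟩ := hy
      obtain rfl : n = f i + k * r := by rw [← hr]; ring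
      rw [← hi]
      exact le_sup_of_le_left (le_sup_of_le_left (le_sup_of_le_left
        (le_iSup₂_of_le i r le_rfl)))

lemma gradientSubspace_mono {Ψ Ψ' : Set H.root} (h : Ψ ⊆ Ψ') :
    gradientSubspace H Ψ ≤ gradientSubspace H Ψ' := by
  rw [gradientSubspace_eq, gradientSubspace_eq, ofFamily_le_ofFamily]
  refine fun _ => sumRootSub_mono (Set.insert_subset_insert ?_)
  rintro _ ⟨i, hi, rfl⟩
  exact ⟨i, h hi, rfl⟩

lemma gradientSubspace_ne_top {Ψ : Set H.root} (h : Ψ ≠ Set.univ) : gradientSubspace H Ψ ≠ ⊤ := by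
  rw [gradientSubspace_eq]
  intro ht
  obtain ⟨i, hi⟩ := (Set.ne_univ_iff_exists_notMem _).1 h
  obtain ⟨x, hx, hx0⟩ := Submodule.exists_mem_ne_zero_of_ne_bot (root_rootSub_ne_bot i)
  have h1 : x ∈ sumRootSub H (gradientWeights Ψ) := by
    rw [ofFamily_eq_top.1 ht 0]
    trivial
  rcases mem_of_mem_sumRootSub hx0 hx h1 with h2 | ⟨j, hj, hji⟩
  · exact root_coe_ne_zero i h2
  · have : j = i := Subtype.ext (DFunLike.coe_injective hji)
    exact hi (this ▸ hj)

lemma isSymmetricRegular_gradientSubspace {Ψ : Set H.root} (hΨ : IsClosedSubroot H Ψ) :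
    IsSymmetricRegular (cartan H) (gradientSubspace H Ψ) := by
  rw [gradientSubspace_eq]
  exact (isSymmetricFamily_gradientWeights hΨ).isSymmetricRegular

/-- `H` has weight `0` and `F 0 = 0`, so the degrees in which it occurs are exactly the multiples of
`k`. This recovers the modulus without reference to `F`. -/
lemma dvd_of_cartan_le {k : ℕ} {F : rootLattice H →ₗ[ℤ] ℤ} {n : ℤ}
    (h : H.toSubmodule ≤ sumRootSub H (congruenceWeights k F n)) : (k : ℤ) ∣ n := by
  obtain ⟨i⟩ := nonempty_root H
  obtain ⟨u, hu⟩ : ∃ u, i.1 u ≠ 0 := by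
    by_contra! h
    exact root_coe_ne_zero i (funext h)
  refine zero_mem_congruenceWeights.1 (mem_of_mem_sumRootSub ?_ (mem_rootSub_zero.2 u.2) (h u.2))
  intro h0
  exact hu (by rw [show u = 0 from Subtype.ext h0]; exact map_zero i.1.toLinear)

lemma sumRootSub_congruenceWeights_one (F : rootLattice H →ₗ[ℤ] ℤ) (n : ℤ) :
    sumRootSub H (congruenceWeights 1 F n) = ⊤ := by
  rw [eq_top_iff]
  refine le_of_forall_weight (H := H) (fun _ _ _ _ => Submodule.mem_top) fun w x _ hx => ?_
  obtain ⟨v, hv⟩ := exists_lattice_eq w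
  exact rootSub_le_sumRootSub (P := congruenceWeights 1 F n) ⟨v, hv, by simp⟩ hx

lemma congruenceWeights_mono {k k' : ℕ} (h : k ∣ k') (F : rootLattice H →ₗ[ℤ] ℤ) (n : ℤ) :
    congruenceWeights k' F n ⊆ congruenceWeights k F n := by
  rintro _ ⟨x, rfl, hx⟩
  exact ⟨x, rfl, (Int.natCast_dvd_natCast.2 h).trans hx⟩

lemma IsSymmetricFamily.gradientSubspace_le {S : ℤ → Submodule ℂ L} (hS : IsSymmetricFamily H S) :
    ofFamily S ≤ gradientSubspace H (IsSymmetricFamily.gradient H S) := by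
  rw [gradientSubspace_eq, ofFamily_le_ofFamily]
  exact hS.le_gradient

variable {s : Submodule ℂ (Affine L)}

lemma isMaximalSymmetricRegular_degZero :
    IsMaximalSymmetricRegular (cartan H) (degZero : Submodule ℂ (Affine L)) := by
  have htop : IsSymmetricRegular (cartan H) (⊤ : Submodule ℂ (Affine L)) := by
    -- The whole algebra is the congruence family of modulus `1`.
    have h : IsSymmetricFamily H fun n => sumRootSub H (congruenceWeights 1 0 n) :=
      isSymmetricFamily_congruenceWeights 1 0
    rw [← ofFamily_eq_top.2 (sumRootSub_congruenceWeights_one (0 : rootLattice H →ₗ[ℤ] ℤ))]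
    exact h.isSymmetricRegular
  exact ⟨⟨isSymmetricRegular_degZero htop, degZero_ne_top⟩,
    fun s hs h => (eq_degZero_of_le h hs.2).le⟩

lemma isMaximalSymmetricRegular_gradientSubspace {Ψ : Set H.root} (hΨ : IsMaximalClosedSubroot H Ψ) :
    IsMaximalSymmetricRegular (cartan H) (gradientSubspace H Ψ) := by
  refine ⟨⟨isSymmetricRegular_gradientSubspace hΨ.prop.1, gradientSubspace_ne_top hΨ.prop.2⟩, ?_⟩
  rintro s ⟨hs, hst⟩ hle
  have hc : (cartan H).toSubmodule ≤ s := le_trans (le_sup_of_le_left le_sup_left) hle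
  have hS := hs.isSymmetricFamily hc
  have hsS := hs.eq_ofFamily hc
  set S : ℤ → Submodule ℂ L := fun n => s.comap (tpow L n)
  rw [hsS] at hle ⊢
  have hΨS : Ψ ⊆ IsSymmetricFamily.gradient H S := fun i hi => by
    rw [gradientSubspace_eq, ofFamily_le_ofFamily] at hle
    exact ⟨0, (rootSub_le_sumRootSub (Or.inr ⟨i, hi, rfl⟩)).trans (hle 0)⟩
  by_cases hu : IsSymmetricFamily.gradient H S = Set.univ
  -- With full gradient, the overalgebra has some modulus `k`. It contains `H ⊗ t`, so `k` divides
  -- `1` and the overalgebra is not proper.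
  · exfalso
    obtain ⟨F, hF⟩ := hS.exists_linear hu
    obtain ⟨k, hk⟩ := hS.exists_eq_sumRootSub_congruenceWeights hF
    have h1 : H.toSubmodule ≤ sumRootSub H (congruenceWeights k F 1) := by
      rw [← hk 1]
      rw [gradientSubspace_eq, ofFamily_le_ofFamily] at hle
      exact fun u hu => hle 1 (rootSub_le_sumRootSub (Or.inl rfl) (mem_rootSub_zero.2 hu))
    have h2 := dvd_of_cartan_le h1
    obtain rfl : k = 1 := by
      have : k ∣ 1 := by exact_mod_cast h2
      exact Nat.dvd_one.1 this
    refine hst (hsS.trans (ofFamily_eq_top.2 fun n => ?_))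
    rw [hk, sumRootSub_congruenceWeights_one]
  · exact hS.gradientSubspace_le.trans
      (gradientSubspace_mono (hΨ.2 ⟨hS.isClosedSubroot_gradient, hu⟩ hΨS))

lemma isMaximalSymmetricRegular_congruenceWeights {k : ℕ} (hk : k.Prime)
    (F : rootLattice H →ₗ[ℤ] ℤ) :
    IsMaximalSymmetricRegular (cartan H)
      (ofFamily fun n => sumRootSub H (congruenceWeights k F n)) := by
  have hT := isSymmetricFamily_congruenceWeights k F
  refine ⟨⟨hT.isSymmetricRegular, fun h => ?_⟩, ?_⟩
  · have h1 : (k : ℤ) ∣ 1 := dvd_of_cartan_le (F := F) (by rw [ofFamily_eq_top.1 h 1]; exact le_top)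
    exact hk.one_lt.ne' (Nat.dvd_one.1 (by exact_mod_cast h1))
  rintro s ⟨hs, hst⟩ hle
  have hc : (cartan H).toSubmodule ≤ s := hT.cartan_le_ofFamily.trans hle
  have hS := hs.isSymmetricFamily hc
  have hsS := hs.eq_ofFamily hc
  set S : ℤ → Submodule ℂ L := fun n => s.comap (tpow L n)
  rw [hsS, ofFamily_le_ofFamily] at hle
  -- The given `F` also serves for the overalgebra, so only the modulus can change, to a divisor of
  -- `k`.
  have hF (i : H.root) : rootSub H i.1 ≤ S (F (latticeRoot i)) :=
    (rootSub_le_sumRootSub (P := congruenceWeights k F (F (latticeRoot i)))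
      ⟨latticeRoot i, rfl, by simp⟩).trans (hle _)
  obtain ⟨k', hk'⟩ := hS.exists_eq_sumRootSub_congruenceWeights hF
  have h1 : H.toSubmodule ≤ sumRootSub H (congruenceWeights k' F k) := by
    rw [← hk' k]
    exact fun u hu => hle k (rootSub_le_sumRootSub (zero_mem_congruenceWeights.2 dvd_rfl)
      (mem_rootSub_zero.2 hu))
  have h2 : k' ∣ k := by exact_mod_cast dvd_of_cartan_le h1
  rcases (Nat.dvd_prime hk).1 h2 with rfl | rfl
  · exfalso
    refine hst (hsS.trans (ofFamily_eq_top.2 fun n => ?_))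
    rw [hk', sumRootSub_congruenceWeights_one]
  · rw [hsS, ofFamily_le_ofFamily]
    exact fun n => (hk' n).le

lemma IsMaximalSymmetricRegular.cases (hs : IsMaximalSymmetricRegular (cartan H) s) :
    s = degZero ∨ (∃ Ψ : Set H.root, IsMaximalClosedSubroot H Ψ ∧ s = gradientSubspace H Ψ) ∨
      ∃ (k : ℕ) (F : rootLattice H →ₗ[ℤ] ℤ), k.Prime ∧
        s = ofFamily fun n => sumRootSub H (congruenceWeights k F n) := by
  obtain ⟨⟨hreg, hst⟩, hmax⟩ := hs
  by_cases ht : s ⊔ (cartan H).toSubmodule = ⊤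
  · refine Or.inl (eq_degZero_of_le ?_ hst)
    -- Here `[g, g] = [s + h, s + h] ⊆ s`.
    rw [← lie_top_eq_degZero, LieSubmodule.lieIdeal_oper_eq_linear_span', Submodule.span_le]
    rintro _ ⟨x, -, y, -, rfl⟩
    exact lie_mem_of_mem_sup_cartan hreg (ht ▸ Submodule.mem_top) (ht ▸ Submodule.mem_top)
  have hc : (cartan H).toSubmodule ≤ s :=
    le_sup_right.trans (hmax ⟨hreg.sup_cartan, ht⟩ le_sup_left)
  have hS := hreg.isSymmetricFamily hc
  have hsS := hreg.eq_ofFamily hc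
  set S : ℤ → Submodule ℂ L := fun n => s.comap (tpow L n)
  right
  by_cases hu : IsSymmetricFamily.gradient H S = Set.univ
  · right
    obtain ⟨F, hF⟩ := hS.exists_linear hu
    obtain ⟨k, hk⟩ := hS.exists_eq_sumRootSub_congruenceWeights hF
    have hk1 : k ≠ 1 := by
      rintro rfl
      refine hst (hsS.trans (ofFamily_eq_top.2 fun n => ?_))
      rw [hk, sumRootSub_congruenceWeights_one]
    -- This covers `k = 0` too: its `minFac` is the prime `2`, which divides `0`.
    have hp := Nat.minFac_prime hk1
    have hle : s ≤ ofFamily fun n => sumRootSub H (congruenceWeights k.minFac F n) := by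
      rw [hsS, ofFamily_le_ofFamily]
      intro n
      rw [hk]
      exact sumRootSub_mono (congruenceWeights_mono k.minFac_dvd F n)
    exact ⟨k.minFac, F, hp, le_antisymm hle
      (hmax (isMaximalSymmetricRegular_congruenceWeights hp F).prop hle)⟩
  · left
    obtain ⟨Ψ, hΨS, hΨ⟩ := (Set.toFinite
      {Ψ : Set H.root | IsClosedSubroot H Ψ ∧ Ψ ≠ Set.univ}).exists_le_maximal
        ⟨hS.isClosedSubroot_gradient, hu⟩
    have hle : s ≤ gradientSubspace H Ψ := by
      -- `Ψ` is a maximal proper closed subroot system above the gradient; it exists because there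
      -- are finitely many roots.
      rw [hsS]
      exact hS.gradientSubspace_le.trans (gradientSubspace_mono hΨS)
    exact ⟨Ψ, hΨ, le_antisymm hle
      (hmax (isMaximalSymmetricRegular_gradientSubspace hΨ).prop hle)⟩

end Maximal

end UntwistedAffine
end

theorem mainTheorem6 {L : Type*} [LieRing L] [LieAlgebra ℂ L] [FiniteDimensional ℂ L]
    [LieAlgebra.IsSimple ℂ L] (H : LieSubalgebra ℂ L) [H.IsCartanSubalgebra]
    (s : Submodule ℂ (UntwistedAffine.Affine L)) :
    UntwistedAffine.IsMaximalSymmetricRegular (UntwistedAffine.Affine.cartan H) s ↔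
      s = (⁅(⊤ : LieIdeal ℂ (UntwistedAffine.Affine L)),
          (⊤ : LieIdeal ℂ (UntwistedAffine.Affine L))⁆ :
            LieIdeal ℂ (UntwistedAffine.Affine L)).toSubmodule ∨
      (∃ Ψ : Set H.root, UntwistedAffine.IsMaximalClosedSubroot H Ψ ∧
        s = UntwistedAffine.gradientSubspace H Ψ) ∨
      (∃ (k : ℕ) (f : H.root → ℤ), k.Prime ∧ UntwistedAffine.IsZLinear H f ∧
        s = UntwistedAffine.congruenceSubspace H k f ⊔
          Submodule.span ℂ {UntwistedAffine.Affine.d L}) := by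
  rw [UntwistedAffine.lie_top_eq_degZero]
  constructor
  · intro hs
    refine hs.cases.imp_right (Or.imp_right ?_)
    rintro ⟨k, F, hk, rfl⟩
    refine ⟨k, fun i => F (UntwistedAffine.latticeRoot i), hk, ⟨F, fun _ => rfl⟩, ?_⟩
    rw [UntwistedAffine.congruenceSubspace_sup_eq k F fun _ => rfl]
  · rintro (rfl | ⟨Ψ, hΨ, rfl⟩ | ⟨k, f, hk, ⟨F, hF⟩, rfl⟩)
    · exact UntwistedAffine.isMaximalSymmetricRegular_degZero
    · exact UntwistedAffine.isMaximalSymmetricRegular_gradientSubspace hΨ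
    · rw [UntwistedAffine.congruenceSubspace_sup_eq k F hF]
      exact UntwistedAffine.isMaximalSymmetricRegular_congruenceWeights hk F
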